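/- \textbf{Setting.} Let $q\in\mathbb C^*$ be not a root of unity, $r_0\in\mathbb C^*$, $2s\in\mathbb Z_{\ge 0}$, and let $\mathrm b^x,\mathrm c^x\in\mathbb C$ ($x\in\{\cdot,*,\diamond\}$) satisfy $\mathrm b^x\mathrm c^x=r_0^{-2}$. We write $\mathrm b=\mathrm b^{\,\cdot}$. Put $\theta^x_M=\mathrm b^xq^{2M}+\mathrm c^xq^{-2M}$, also for $M=s$, put $[X,Y]_q=qXY-q^{-1}YX$, $(a;q)_n=\prod_{k=0}^{n-1}(1-aq^k)$, and $$\omega^{\{x,y,z\}}=-(q-q^{-1})^2\Big(\theta^x_s\theta^y_s-\tfrac1{r_0}(q^{2s+1}+q^{-2s-1})\theta^z_s\Big).$$ Let $V$ be a complex vector space of dimension $2s+1$ and let $A,A^*,A^\diamond\in\mathrm{End}(V)$ satisfy the Askey--Wilson relations $$[A,[A,A^*]_q]_{q^{-1}}=\rho A^*+\omega^{\{\cdot,*,\diamond\}}A+\tfrac{q+q^{-1}}{r_0}\omega^{\{\cdot,\diamond,*\}}I,\qquad [A^*,[A^*,A]_q]_{q^{-1}}=\rho A+\omega^{\{\cdot,*,\diamond\}}A^*+\tfrac{q+q^{-1}}{r_0}\omega^{\{*,\diamond,\cdot\}}I$$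 with $\rho=-(q^2-q^{-2})^2/r_0^2$, and $$A^\diamond=\frac{r_0}{q^2-q^{-2}}[A^*,A]_q+\frac{r_0\,\omega^{\{\cdot,*,\diamond\}}}{(q-q^{-1})(q^2-q^{-2})}I .$$ Assume that $(A,A^*,A^\diamond)$ is a Leonard triple with spectra $\theta^x_0,\dots,\theta^x_{2s}$: for each of the three maps $A^x$ there is a basis of $V$ in which $A^x$ is $\mathrm{diag}(\theta^x_0,\dots,\theta^x_{2s})$ and the other two maps are irreducible tridiagonal. \textbf{Eigenbases.} Let $(a,b,c)$ be one of $(\cdot,*,\diamond),(*,\diamond,\cdot),(\diamond,\cdot,*)$. For $(x,y,z)=(a,b,c)$ let $A^{(y,x)}=A^{(b,a)}$ be the tridiagonal matrix (indices $0,\dots,2s$) with entries $$A^{(b,a)}_{M,M-1}=q^{2-4s}\frac{(1-q^{2M})(\mathrm c^a-\mathrm b^aq^{2M+4s})(\mathrm b^b\mathrm b^cr_0q^{4s-1}+\mathrm b^aq^{2M-2})(\mathrm c^a\mathrm c^cr_0q^{-1}+\mathrm c^bq^{2M-2})}{(\mathrm c^a-\mathrm b^aq^{4M-2})(\mathrm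 c^a-\mathrm b^aq^{4M})},$$ $$A^{(b,a)}_{M-1,M}=\frac{(1-q^{2M-4s-2})(\mathrm c^a-\mathrm b^aq^{2M-2})(\mathrm c^a+\mathrm b^b\mathrm b^cr_0q^{2M+4s-1})(\mathrm c^b+\mathrm b^a\mathrm c^cr_0q^{2M-1})}{(\mathrm c^a-\mathrm b^aq^{4M-4})(\mathrm c^a-\mathrm b^aq^{4M-2})},$$ $$A^{(b,a)}_{M,M}=\theta^b_0-A^{(b,a)}_{M,M+1}-A^{(b,a)}_{M,M-1},$$ where $A^{(b,a)}_{2s,2s+1}=A^{(b,a)}_{0,-1}=0$ and identical factors of numerator and denominator (for $M=2s$ in the first, for $M=1$ in the second formula) are cancelled. Let $A^{(a,b)}$ be obtained from $A^{(b,a)}$ by exchanging $\mathrm b^a\leftrightarrow\mathrm b^b$, $\mathrm c^a\leftrightarrow\mathrm c^b$, $\mathrm b^cq^{4s}\leftrightarrow\mathrm c^c$, and let $A^{(b,c)}$ be obtained from $A^{(a,b)}$ by the substitution $(a,b,c)\to(b,c,a)$. Let $\{|\theta^x_M\rangle\}_{M=0}^{2s}$ ($x=a,b,c$) be bases of $V$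 with $A^x|\theta^x_M\rangle=\theta^x_M|\theta^x_M\rangle$ and $$A^b|\theta^a_M\rangle=\sum_NA^{(b,a)}_{N,M}|\theta^a_N\rangle,\quad A^a|\theta^b_M\rangle=\sum_NA^{(a,b)}_{N,M}|\theta^b_N\rangle,\quad A^b|\theta^c_M\rangle=\sum_NA^{(b,c)}_{N,M}|\theta^c_N\rangle,$$ the first two being scaled relative to each other by $|\theta^b_0\rangle=\sum_M|\theta^a_M\rangle$. \textbf{Normalization scalars.} Nonzero scalars $f_0,g_0,h_0$ are called normalization scalars of the three eigenbases if $$|\theta^c_0\rangle=\sum_{M=0}^{2s}g_M|\theta^b_M\rangle,\qquad |\theta^a_0\rangle=\sum_{M=0}^{2s}f_0^{-1}h_M|\theta^c_M\rangle,$$ where $$g_M=g_0\prod_{k=0}^{M-1}q^{4k}\frac{\mathrm b^b}{\mathrm c^b}\,\frac{\mathrm c^bq^{-2k}+r_0q\,\mathrm c^a\mathrm b^c}{\mathrm b^bq^{2k}+r_0q^{-1}\mathrm c^a\mathrm b^c},\qquad h_M=h_0\prod_{k=0}^{M-1}q^{4k}\frac{\mathrm b^c}{\mathrm c^c}\,\frac{\mathrm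 c^cq^{-2k}+r_0q\,\mathrm c^b\mathrm b^a}{\mathrm b^cq^{2k}+r_0q^{-1}\mathrm c^b\mathrm b^a}.$$ \textbf{Proposition.} Normalization scalars exist, and all normalization scalars $f_0,g_0,h_0$ satisfy $$f_0h_0^{-1}g_0^{-1}=(-1)^{2s}q^{2s(2s-1)}\frac{(q^2r_0^2\mathrm b^2;q^2)_{2s}\,(q^2r_0^2(\mathrm b^\diamond)^2;q^2)_{2s}\,(q^2r_0^2(\mathrm b^*)^2;q^2)_{2s}}{\Big(-\frac{qr_0\mathrm b\mathrm b^\diamond}{\mathrm b^*};q^2\Big)_{2s}\Big(-\frac{qr_0\mathrm b\mathrm b^*}{\mathrm b^\diamond};q^2\Big)_{2s}\Big(-\frac{qr_0\mathrm b^\diamond\mathrm b^*}{\mathrm b};q^2\Big)_{2s}}.$$ -/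

import Mathlib

open scoped BigOperators

noncomputable section

namespace QRacahTriple

/-- The `q`-shifted factorial `(a;q)_n`. -/
def qPoch (a q : ℂ) (n : ℕ) : ℂ := ∏ k ∈ Finset.range n, (1 - a * q ^ k)

/-- The `q`-commutator `[X,Y]_q = q X Y - q⁻¹ Y X`. -/
def qComm {V : Type*} [AddCommGroup V] [Module ℂ V] (q : ℂ) (X Y : Module.End ℂ V) :
    Module.End ℂ V :=
  q • (X * Y) - q⁻¹ • (Y * X)

/-- `θ_M = b q^{2M} + c q^{-2M}`. -/
def theta (q b c : ℂ) (M : ℕ) : ℂ := b * q ^ (2 * (M : ℤ)) + c * q ^ (-2 * (M : ℤ))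

/-- `θ_s = b q^{2s} + c q^{-2s}` for the integer or half-integer `s = d / 2`. -/
def thetaMid (d : ℕ) (q b c : ℂ) : ℂ := b * q ^ (d : ℤ) + c * q ^ (-(d : ℤ))

/-- The scalar `ω^{i,j,k}`, with `d = 2s`. -/
def omega (d : ℕ) (q r₀ : ℂ) (b c : Fin 3 → ℂ) (i j k : Fin 3) : ℂ :=
  -(q - q⁻¹) ^ 2 * (thetaMid d q (b i) (c i) * thetaMid d q (b j) (c j)
    - r₀⁻¹ * (q ^ ((d : ℤ) + 1) + q ^ (-(d : ℤ) - 1)) * thetaMid d q (b k) (c k))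

/-- Irreducible tridiagonal matrices. -/
def IsIrreducibleTridiagonal {n : ℕ} (T : Matrix (Fin n) (Fin n) ℂ) : Prop :=
  ∀ M N : Fin n,
    ((M.val = N.val + 1 ∨ N.val = M.val + 1) → T M N ≠ 0) ∧
    ((N.val + 1 < M.val ∨ M.val + 1 < N.val) → T M N = 0)

/-- `(A 0, A 1, A 2) = (A, A^*, A^⋄)` is a Leonard triple of `q`-Racah type in dimension `d + 1`,
with parameters `q, r₀` and `(b i, c i)`. -/
structure IsLeonardTriple {V : Type*} [AddCommGroup V] [Module ℂ V]
    (d : ℕ) (q r₀ : ℂ) (b c : Fin 3 → ℂ) (A : Fin 3 → Module.End ℂ V) : Prop where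
  /-- `r₀⁻² = b^i c^i` for each of the three indices. -/
  param : ∀ i, b i * c i = (r₀ ^ 2)⁻¹
  /-- Each map is diagonal, with eigenvalue sequence `θ^i_0, …, θ^i_d`, in some basis in which the
  other two maps are irreducible tridiagonal. -/
  leonard : ∀ i, ∃ u : Module.Basis (Fin (d + 1)) ℂ V,
    (∀ M, A i (u M) = theta q (b i) (c i) M • u M) ∧
    ∀ j, j ≠ i → IsIrreducibleTridiagonal (LinearMap.toMatrix u u (A j))
  /-- First Askey-Wilson relation for `(A, A^*)`. -/
  aw_first : qComm q⁻¹ (A 0) (qComm q (A 0) (A 1)) =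
    (-(q ^ 2 - (q ^ 2)⁻¹) ^ 2 / r₀ ^ 2) • A 1 + omega d q r₀ b c 0 1 2 • A 0
      + ((q + q⁻¹) / r₀ * omega d q r₀ b c 0 2 1) • (1 : Module.End ℂ V)
  /-- Second Askey-Wilson relation for `(A, A^*)`. -/
  aw_second : qComm q⁻¹ (A 1) (qComm q (A 1) (A 0)) =
    (-(q ^ 2 - (q ^ 2)⁻¹) ^ 2 / r₀ ^ 2) • A 0 + omega d q r₀ b c 0 1 2 • A 1
      + ((q + q⁻¹) / r₀ * omega d q r₀ b c 1 2 0) • (1 : Module.End ℂ V)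
  /-- The third map is built from the first two. -/
  third : A 2 = (r₀ / (q ^ 2 - (q ^ 2)⁻¹)) • qComm q (A 1) (A 0)
      + (r₀ * omega d q r₀ b c 0 1 2 / ((q - q⁻¹) * (q ^ 2 - (q ^ 2)⁻¹))) • (1 : Module.End ℂ V)

/-- The entry `A^{(y,x)}_{M,M-1}`. For `M = d` the factor
`(c^x - b^x q^{2M+2d}) / (c^x - b^x q^{4M})` has equal numerator and denominator and is read
as `1`, also if both vanish. -/
def subEntry (d : ℕ) (q r₀ bx cx bY cY bz cz : ℂ) (M : ℕ) : ℂ :=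
  q ^ (2 - 2 * (d : ℤ)) * (1 - q ^ (2 * (M : ℤ)))
    * (if M = d then 1 else
        (cx - bx * q ^ (2 * (M : ℤ) + 2 * (d : ℤ))) / (cx - bx * q ^ (4 * (M : ℤ))))
    * (bY * bz * r₀ * q ^ (2 * (d : ℤ) - 1) + bx * q ^ (2 * (M : ℤ) - 2))
    * (cx * cz * r₀ * q⁻¹ + cY * q ^ (2 * (M : ℤ) - 2))
    / (cx - bx * q ^ (4 * (M : ℤ) - 2))

/-- The entry `A^{(y,x)}_{M-1,M}`. For `M = 1` the factor
`(c^x - b^x q^{2M-2}) / (c^x - b^x q^{4M-4})` has equal numerator and denominator and is read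
as `1`, also if both vanish. -/
def superEntry (d : ℕ) (q r₀ bx cx bY cY bz cz : ℂ) (M : ℕ) : ℂ :=
  (1 - q ^ (2 * (M : ℤ) - 2 * (d : ℤ) - 2))
    * (if M = 1 then 1 else
        (cx - bx * q ^ (2 * (M : ℤ) - 2)) / (cx - bx * q ^ (4 * (M : ℤ) - 4)))
    * (cx + bY * bz * r₀ * q ^ (2 * (M : ℤ) + 2 * (d : ℤ) - 1))
    * (cY + bx * cz * r₀ * q ^ (2 * (M : ℤ) - 1))
    / (cx - bx * q ^ (4 * (M : ℤ) - 2))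

/-- The tridiagonal matrix `(A^{(y,x)}_{M,N})` by which `A^y` acts on the eigenbasis of `A^x`,
as a function of the parameters of `x`, of `y` and of the third index `z`. -/
def tridiag (d : ℕ) (q r₀ bx cx bY cY bz cz : ℂ) : Matrix (Fin (d + 1)) (Fin (d + 1)) ℂ :=
  Matrix.of fun M N =>
    if M.val = N.val + 1 then subEntry d q r₀ bx cx bY cY bz cz M
    else if N.val = M.val + 1 then superEntry d q r₀ bx cx bY cY bz cz N
    else if M = N then
      theta q bY cY 0 - superEntry d q r₀ bx cx bY cY bz cz (M.val + 1)
        - subEntry d q r₀ bx cx bY cY bz cz M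
    else 0

/-- `A^{(b,a)}` for `(a,b,c) = (i,i+1,i+2)`. -/
def matBA (d : ℕ) (q r₀ : ℂ) (b c : Fin 3 → ℂ) (i : Fin 3) :
    Matrix (Fin (d + 1)) (Fin (d + 1)) ℂ :=
  tridiag d q r₀ (b i) (c i) (b (i + 1)) (c (i + 1)) (b (i + 2)) (c (i + 2))

/-- `A^{(a,b)}` for `(a,b,c) = (i,i+1,i+2)`: obtained from `A^{(b,a)}` by exchanging the
parameters of `a` and `b`, and `b^c q^{2d}` with `c^c`. -/
def matAB (d : ℕ) (q r₀ : ℂ) (b c : Fin 3 → ℂ) (i : Fin 3) :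
    Matrix (Fin (d + 1)) (Fin (d + 1)) ℂ :=
  tridiag d q r₀ (b (i + 1)) (c (i + 1)) (b i) (c i)
    (c (i + 2) * q ^ (-2 * (d : ℤ))) (b (i + 2) * q ^ (2 * (d : ℤ)))

/-- The eigenbases `|θ^a_M⟩, |θ^b_M⟩, |θ^c_M⟩` of the maps `A^a, A^b, A^c`, where
`(a,b,c) = (i,i+1,i+2)`. The actions of the second map determine each basis up to an overall
scalar; `rel` fixes the bases for `a` and `b` relative to each other. The basis `|θ^b_M⟩` is
expanded in `|θ^a_M⟩` with a transition matrix whose column of index `0` has all entries `1`. -/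
structure IsEigenbases {V : Type*} [AddCommGroup V] [Module ℂ V]
    (d : ℕ) (q r₀ : ℂ) (b c : Fin 3 → ℂ) (A : Fin 3 → Module.End ℂ V) (i : Fin 3)
    (va vb vc : Module.Basis (Fin (d + 1)) ℂ V) : Prop where
  eig_a : ∀ M, A i (va M) = theta q (b i) (c i) M • va M
  act_a : ∀ M, A (i + 1) (va M) = ∑ N, matBA d q r₀ b c i N M • va N
  eig_b : ∀ M, A (i + 1) (vb M) = theta q (b (i + 1)) (c (i + 1)) M • vb M
  act_b : ∀ M, A i (vb M) = ∑ N, matAB d q r₀ b c i N M • vb N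
  eig_c : ∀ M, A (i + 2) (vc M) = theta q (b (i + 2)) (c (i + 2)) M • vc M
  act_c : ∀ M, A (i + 1) (vc M) = ∑ N, matAB d q r₀ b c (i + 1) N M • vc N
  rel : vb 0 = ∑ M, va M

/-- `g_M / g_0` for `(a,b,c) = (i,i+1,i+2)`. -/
def gRatio (q r₀ : ℂ) (b c : Fin 3 → ℂ) (i : Fin 3) (M : ℕ) : ℂ :=
  ∏ k ∈ Finset.range M, q ^ (4 * (k : ℤ)) * (b (i + 1) / c (i + 1)) *
    ((c (i + 1) * q ^ (-2 * (k : ℤ)) + r₀ * q * c i * b (i + 2)) /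
      (b (i + 1) * q ^ (2 * (k : ℤ)) + r₀ * q⁻¹ * c i * b (i + 2)))

/-- `h_M / h_0` for `(a,b,c) = (i,i+1,i+2)`. -/
def hRatio (q r₀ : ℂ) (b c : Fin 3 → ℂ) (i : Fin 3) (M : ℕ) : ℂ :=
  ∏ k ∈ Finset.range M, q ^ (4 * (k : ℤ)) * (b (i + 2) / c (i + 2)) *
    ((c (i + 2) * q ^ (-2 * (k : ℤ)) + r₀ * q * c (i + 1) * b i) /
      (b (i + 2) * q ^ (2 * (k : ℤ)) + r₀ * q⁻¹ * c (i + 1) * b i))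

/-- `f₀, g₀, h₀` are normalization scalars of the three eigenbases: with `g_M = g₀ (g_M / g_0)` and
`h_M = h₀ (h_M / h_0)`, the vectors of index `0` have the expansions
`|θ^c_0⟩ = ∑ g_M |θ^b_M⟩` and `|θ^a_0⟩ = ∑ f₀⁻¹ h_M |θ^c_M⟩`, i.e. the columns of index `0`
of the transition relations `|θ^c_N⟩ = ∑ g_M P^{b,c}_{M N} |θ^b_M⟩` and
`|θ^a_N⟩ = ∑ f_N⁻¹ h_M P^{c,a}_{M N} |θ^c_M⟩`, where `P_{M 0} = 1`. -/
structure IsNormalization {V : Type*} [AddCommGroup V] [Module ℂ V]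
    (d : ℕ) (q r₀ : ℂ) (b c : Fin 3 → ℂ) (i : Fin 3)
    (va vb vc : Module.Basis (Fin (d + 1)) ℂ V) (f₀ g₀ h₀ : ℂ) : Prop where
  f_ne : f₀ ≠ 0
  g_ne : g₀ ≠ 0
  h_ne : h₀ ≠ 0
  c_to_b : vc 0 = ∑ M : Fin (d + 1), (g₀ * gRatio q r₀ b c i M) • vb M
  a_to_c : va 0 = ∑ M : Fin (d + 1), (f₀⁻¹ * (h₀ * hRatio q r₀ b c i M)) • vc M

end QRacahTriple

end

noncomputable section

namespace QRacahTriple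


/-! Everything is computed in the eigenbasis |θ^b_M⟩ of the middle map. Let H be the coefficient of
|θ^c_0⟩ in |θ^a_0⟩. Then H = f₀⁻¹h₀, so the quantity sought is the inverse of g₀H.

The rows of the matrix of A^a in this basis all sum to θ^a_0 (`row_sum`). Eigenspaces are
one-dimensional, so |θ^a_0⟩ = l Σ_M |θ^b_M⟩ for a scalar l. Hence H = l Σ_M n_M, where n_M is the
coefficient of |θ^c_0⟩ in |θ^b_M⟩.

The Askey-Wilson relations say that, for each cyclic order, A^c is an affine function of [A^b,
A^a]_q (`third_eq`). So A^c is an explicit tridiagonal matrix in the same basis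
(`third_apply_basis`). The vector (g_M) is a right eigenvector of it for θ^c_0 (`third_mul_ratio`).
This already gives existence of the scalars. The sequence (n_M) is a left eigenvector for the same
eigenvalue, and the vanishing Casoratian (`tri_left_right_eigenvector`) yields the ratios
n_{M+1}/n_M.

Multiplied by ∏_{j≠M}(θ_M - θ_j), the sequence n_M satisfies a recursion with very simple
coefficients. Then Σ n_M is a divided difference at the nodes θ^b_M, and all divided differences
over consecutive nodes have product form (`sum_left_eigenvector`).

There remain l and n_0. Applying ∏_{k≥1}(T - θ_k) to |θ^b_0⟩ and reading off the last coordinate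
(`prod_hessenberg`) determines l for T = A^a, thanks to the relative scaling of the first two bases.
For T = A^c it determines n_0 g_d, which contains exactly the factor g₀ needed, so the arbitrary
scale of the third basis drops out. `prod_closed_form` collapses the resulting product. -/

/-! ### Tridiagonal matrices -/

/-- The tridiagonal matrix with subdiagonal `lo`, diagonal `di` and superdiagonal `up`. -/
def tri (d : ℕ) (lo di up : ℕ → ℂ) : Matrix (Fin (d + 1)) (Fin (d + 1)) ℂ :=
  Matrix.of fun M N =>
    if M.val = N.val + 1 then lo M else if N.val = M.val + 1 then up N
    else if M = N then di M else 0

theorem tri_apply_swap (d : ℕ) (lo di up : ℕ → ℂ) (M N : Fin (d + 1)) :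
    tri d lo di up M N = tri d up di lo N M := by
  simp only [tri, Matrix.of_apply]
  split_ifs with h1 h2 h3 h4 h5 <;> first | rfl | omega | (subst_vars; rfl)

theorem sum_tri_mul (d : ℕ) (lo di up g : ℕ → ℂ) (M : Fin (d + 1)) :
    ∑ N : Fin (d + 1), tri d lo di up M N * g N =
      (if M.val = 0 then 0 else lo M * g (M - 1)) + di M * g M
        + (if M.val = d then 0 else up (M + 1) * g (M + 1)) := by
  have key : ∀ N : Fin (d + 1), tri d lo di up M N * g N =
      (if M.val = N.val + 1 then lo M * g (M - 1) else 0) + (if M = N then di M * g M else 0)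
        + (if N.val = M.val + 1 then up (M + 1) * g (M + 1) else 0) := by
    intro N
    simp only [tri, Matrix.of_apply]
    by_cases h1 : M.val = N.val + 1
    · have h2 : ¬ N.val = M.val + 1 := by omega
      have h3 : M ≠ N := by rintro rfl; omega
      have h4 : M.val - 1 = N.val := by omega
      rw [if_pos h1, if_pos h1, if_neg h2, if_neg h3, h4]; ring
    · by_cases h2 : N.val = M.val + 1
      · have h3 : M ≠ N := by rintro rfl; omega
        rw [if_neg h1, if_pos h2, if_neg h1, if_neg h3, if_pos h2, h2]; ring
      · by_cases h3 : M = N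
        · subst h3; simp
        · simp [h1, h2, h3]
  rw [Finset.sum_congr rfl fun N _ => key N, Finset.sum_add_distrib, Finset.sum_add_distrib]
  congr 1
  · congr 1
    · split_ifs with hM
      · exact Finset.sum_eq_zero fun N _ => if_neg (by omega)
      · rw [Finset.sum_eq_single (⟨M.val - 1, by omega⟩ : Fin (d + 1))]
        · rw [if_pos]; simp; omega
        · intro N _ hN
          rw [if_neg]
          intro h; apply hN; ext; simp; omega
        · simp
    · simp
  · split_ifs with hM
    · exact Finset.sum_eq_zero fun N _ => if_neg (by omega)
    · rw [Finset.sum_eq_single (⟨M.val + 1, by omega⟩ : Fin (d + 1))]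
      · simp
      · intro N _ hN
        rw [if_neg]
        intro h; apply hN; ext; simp; omega
      · simp

theorem sum_mul_tri (d : ℕ) (lo di up g : ℕ → ℂ) (M : Fin (d + 1)) :
    ∑ N : Fin (d + 1), g N * tri d lo di up N M =
      (if M.val = 0 then 0 else up M * g (M - 1)) + di M * g M
        + (if M.val = d then 0 else lo (M + 1) * g (M + 1)) := by
  rw [← sum_tri_mul d up di lo g M]
  refine Finset.sum_congr rfl fun N _ => ?_
  rw [tri_apply_swap, mul_comm]

/-- Left and right eigenvectors of a tridiagonal matrix for the same eigenvalue have vanishing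
Casoratian. -/
theorem tri_left_right_eigenvector (d : ℕ) (lo di up g n : ℕ → ℂ) (γ : ℂ)
    (hg : ∀ M : Fin (d + 1), ∑ N : Fin (d + 1), tri d lo di up M N * g N = γ * g M)
    (hn : ∀ M : Fin (d + 1), ∑ N : Fin (d + 1), n N * tri d lo di up N M = γ * n M)
    (M : ℕ) (hM : M < d) :
    n (M + 1) * lo (M + 1) * g M = n M * up (M + 1) * g (M + 1) := by
  induction M with
  | zero =>
    have h1 := hg ⟨0, by omega⟩
    have h2 := hn ⟨0, by omega⟩
    rw [sum_tri_mul] at h1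
    rw [sum_mul_tri] at h2
    simp only [if_true, if_neg (show ¬ 0 = d by omega), zero_add] at h1 h2
    linear_combination g 0 * h2 - n 0 * h1
  | succ M ih =>
    have h1 := hg ⟨M + 1, by omega⟩
    have h2 := hn ⟨M + 1, by omega⟩
    rw [sum_tri_mul] at h1
    rw [sum_mul_tri] at h2
    simp only [if_neg (show ¬ M + 1 = d by omega), Nat.add_eq_zero_iff, one_ne_zero, and_false,
      if_false, Nat.add_sub_cancel] at h1 h2
    linear_combination g (M + 1) * h2 - n (M + 1) * h1 + ih (by omega)

/-- Row `k` of the eigenvalue equation expresses `x (k + 1)`, with a nonzero coefficient, through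
earlier entries. So `x 0` determines the whole eigenvector. -/
theorem IsIrreducibleTridiagonal.eq_zero_of_mulVec {d : ℕ} {T : Matrix (Fin (d + 1)) (Fin (d + 1)) ℂ}
    (hT : IsIrreducibleTridiagonal T) {γ : ℂ} {x : Fin (d + 1) → ℂ}
    (hx : T.mulVec x = γ • x) (h0 : x 0 = 0) : x = 0 := by
  have key : ∀ k : ℕ, ∀ M : Fin (d + 1), M.val ≤ k → x M = 0 := by
    intro k
    induction k with
    | zero =>
      intro M hM
      have : M = 0 := by ext; simpa using hM
      rw [this, h0]
    | succ k ih =>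
      intro M hM
      rcases Nat.lt_or_ge M.val (k + 1) with h | h
      · exact ih M (by omega)
      have hMk : M.val = k + 1 := by omega
      have hrow := congrFun hx ⟨k, by omega⟩
      rw [Matrix.mulVec, dotProduct, Finset.sum_eq_single M] at hrow
      · rw [Pi.smul_apply, ih ⟨k, by omega⟩ le_rfl, smul_zero] at hrow
        exact (mul_eq_zero.mp hrow).resolve_left ((hT _ _).1 (Or.inr hMk))
      · intro N _ hN
        rcases Nat.lt_or_ge N.val (k + 1) with h' | h'
        · rw [ih N (by omega), mul_zero]
        · have : N.val ≠ M.val := fun h => hN (Fin.ext h)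
          rw [(hT ⟨k, by omega⟩ N).2 (Or.inr (by simp only; omega)), zero_mul]
      · simp
  funext M
  exact key M M le_rfl

variable {V : Type*} [AddCommGroup V] [Module ℂ V]

/-- The coordinate of index 0 is injective on each eigenspace, so eigenspaces are at most
one-dimensional. -/
theorem exists_smul_eq_of_irreducibleTridiagonal {d : ℕ} (u : Module.Basis (Fin (d + 1)) ℂ V)
    {T : Module.End ℂ V} (hT : IsIrreducibleTridiagonal (LinearMap.toMatrix u u T))
    {γ : ℂ} {v w : V} (hv : T v = γ • v) (hw : T w = γ • w) (hv0 : v ≠ 0) :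
    ∃ t : ℂ, w = t • v := by
  have hz : ∀ z : V, T z = γ • z → u.repr z 0 = 0 → z = 0 := by
    intro z hz h0
    have : (u.repr z : Fin (d + 1) → ℂ) = 0 := by
      refine hT.eq_zero_of_mulVec (γ := γ) ?_ h0
      rw [LinearMap.toMatrix_mulVec_repr, hz]
      simp
    apply u.repr.injective
    ext M
    simpa using congrFun this M
  have hv1 : u.repr v 0 ≠ 0 := fun h => hv0 (hz v hv h)
  refine ⟨u.repr w 0 / u.repr v 0, ?_⟩
  rw [← sub_eq_zero]
  apply hz
  · rw [map_sub, map_smul, hv, hw, smul_sub, smul_comm]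
  · simp [hv1]

theorem repr_of_diagonal {n : ℕ} {v : Module.Basis (Fin n) ℂ V} {T : Module.End ℂ V} {θ : ℕ → ℂ}
    (hv : ∀ M : Fin n, T (v M) = θ M • v M) (x : V) (M : Fin n) :
    v.repr (T x) M = θ M * v.repr x M := by
  conv_lhs => rw [← v.sum_repr x]
  simp only [map_sum, map_smul, hv, Finsupp.finsetSum_apply, Finsupp.smul_apply,
    Module.Basis.repr_self, smul_eq_mul]
  rw [Finset.sum_eq_single M]
  · simp [mul_comm]
  · intro N _ hN
    simp [hN]
  · simp

/-- The extremal entry of the projection onto the first eigenspace of a map which is Hessenberg with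
respect to the basis `u` and diagonal with respect to the basis `v`. -/
theorem prod_hessenberg {d : ℕ} (u v : Module.Basis (Fin (d + 1)) ℂ V) (T : Module.End ℂ V)
    (θ s : ℕ → ℂ) (hv : ∀ M : Fin (d + 1), T (v M) = θ M • v M)
    (hlow : ∀ M N : Fin (d + 1), M.val + 1 < N.val → u.repr (T (u M)) N = 0)
    (hs : ∀ M N : Fin (d + 1), N.val = M.val + 1 → u.repr (T (u M)) N = s M) :
    ∏ k ∈ Finset.range d, s k =
      (∏ k ∈ Finset.range d, (θ 0 - θ (k + 1))) * v.repr (u 0) 0 * u.repr (v 0) (Fin.last d) := by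
  -- `w k = (T - θ k) ⋯ (T - θ 1) (u 0)`. In the basis `u` each factor reaches one index further and
  -- contributes one `s`. In the basis `v` the full product `w d` retains only the component along
  -- `v 0`.
  let w : ℕ → V := fun n => Nat.rec (u 0) (fun k x => T x - θ (k + 1) • x) n
  have hw : ∀ k, w (k + 1) = T (w k) - θ (k + 1) • w k := fun k => rfl
  have hu : ∀ k ≤ d, (∀ N : Fin (d + 1), k < N.val → u.repr (w k) N = 0) ∧
      ∀ N : Fin (d + 1), N.val = k → u.repr (w k) N = ∏ j ∈ Finset.range k, s j := by
    intro k
    induction k with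
    | zero =>
      intro _
      constructor
      · intro N hN
        have : (0 : Fin (d + 1)) ≠ N := by rintro rfl; simp at hN
        simp [w, this]
      · intro N hN
        have : N = 0 := by ext; simpa using hN
        simp [w, this]
    | succ k ih =>
      intro hk
      obtain ⟨ih1, ih2⟩ := ih (by omega)
      have hexp : ∀ N, u.repr (T (w k)) N = ∑ M, u.repr (w k) M * u.repr (T (u M)) N := by
        intro N
        conv_lhs => rw [← u.sum_repr (w k)]
        simp only [map_sum, map_smul, Finsupp.finsetSum_apply, Finsupp.smul_apply, smul_eq_mul]
      constructor
      · intro N hN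
        rw [hw, map_sub, Finsupp.sub_apply, hexp, map_smul, Finsupp.smul_apply, ih1 N (by omega),
          smul_zero, sub_zero]
        refine Finset.sum_eq_zero fun M _ => ?_
        rcases Nat.lt_or_ge k M.val with h | h
        · rw [ih1 M h, zero_mul]
        · rw [hlow M N (by omega), mul_zero]
      · intro N hN
        rw [hw, map_sub, Finsupp.sub_apply, hexp, map_smul, Finsupp.smul_apply, ih1 N (by omega),
          smul_zero, sub_zero, Finset.prod_range_succ,
          Finset.sum_eq_single (⟨k, by omega⟩ : Fin (d + 1))]
        · rw [ih2 _ rfl, hs _ N (by simpa using hN)]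
        · intro M _ hM
          have hMk : M.val ≠ k := fun h => hM (Fin.ext h)
          rcases Nat.lt_or_ge k M.val with h | h
          · rw [ih1 M h, zero_mul]
          · rw [hlow M N (by omega), mul_zero]
        · simp
  have hT := repr_of_diagonal hv
  have hvk : ∀ k M, v.repr (w k) M =
      (∏ j ∈ Finset.range k, (θ M - θ (j + 1))) * v.repr (u 0) M := by
    intro k M
    induction k with
    | zero => simp [w]
    | succ k ih =>
      rw [hw, map_sub, Finsupp.sub_apply, hT, map_smul, Finsupp.smul_apply, ih,
        Finset.prod_range_succ, smul_eq_mul]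
      ring
  have hwd : w d = ((∏ k ∈ Finset.range d, (θ 0 - θ (k + 1))) * v.repr (u 0) 0) • v 0 := by
    rw [← v.sum_repr (w d), Finset.sum_eq_single 0]
    · rw [hvk]; rfl
    · intro M _ hM
      have hM' : M.val ≠ 0 := fun h => hM (Fin.ext h)
      rw [hvk, Finset.prod_eq_zero (i := M.val - 1), zero_mul, zero_smul]
      · rw [Finset.mem_range]; omega
      · rw [Nat.sub_add_cancel (by omega), sub_self]
    · simp
  rw [← (hu d le_rfl).2 (Fin.last d) rfl, hwd]
  simp


/-! ### Divided differences -/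

/-- Deleting the node `a` removes the factor `(θ k - θ a)⁻¹` from each weight. The added term `k =
a` on the right is zero. -/
theorem sum_nodalWeight_erase_sub {s : Finset ℕ} {θ : ℕ → ℂ} (hθ : Set.InjOn θ s) (f : ℕ → ℂ)
    {a : ℕ} (ha : a ∈ s) :
    ∑ k ∈ s.erase a, f k * Lagrange.nodalWeight (s.erase a) θ k =
      ∑ k ∈ s, f k * Lagrange.nodalWeight s θ k * (θ k - θ a) := by
  rw [← Finset.sum_erase s (a := a) (by simp)]
  refine Finset.sum_congr rfl fun k hk => ?_
  obtain ⟨hka, hks⟩ := Finset.mem_erase.mp hk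
  have h0 : θ k - θ a ≠ 0 := sub_ne_zero.mpr fun h => hka (hθ hks ha h)
  rw [Lagrange.nodalWeight, Lagrange.nodalWeight,
    ← Finset.mul_prod_erase (s.erase k) _ (Finset.mem_erase.mpr ⟨Ne.symm hka, ha⟩),
    Finset.erase_right_comm]
  field_simp

/-- Evaluation of a divided difference from a solution of the defining recursion. -/
theorem sum_nodalWeight_eq_of_recursion {d : ℕ} {θ f : ℕ → ℂ} {Φ : ℕ → ℕ → ℂ}
    (hθ : ∀ a b, a ≤ d → b ≤ d → θ a = θ b → a = b) (h0 : ∀ m, Φ m 0 = f m)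
    (hΦ : ∀ m n, m + n < d → (θ (m + n + 1) - θ m) * Φ m (n + 1) = Φ (m + 1) n - Φ m n)
    (n m : ℕ) (hmn : m + n ≤ d) :
    ∑ k ∈ Finset.Icc m (m + n), f k * Lagrange.nodalWeight (Finset.Icc m (m + n)) θ k = Φ m n := by
  induction n generalizing m with
  | zero => simp [h0, Lagrange.nodalWeight]
  | succ n ih =>
    have hinj : Set.InjOn θ (Finset.Icc m (m + (n + 1)) : Finset ℕ) := by
      intro a ha b hb
      simp only [Finset.coe_Icc, Set.mem_Icc] at ha hb
      exact hθ a b (by omega) (by omega)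
    have e1 : (Finset.Icc m (m + (n + 1))).erase m = Finset.Icc (m + 1) (m + 1 + n) := by
      ext x; simp only [Finset.mem_erase, Finset.mem_Icc]; omega
    have e2 : (Finset.Icc m (m + (n + 1))).erase (m + (n + 1)) = Finset.Icc m (m + n) := by
      ext x; simp only [Finset.mem_erase, Finset.mem_Icc]; omega
    have h1 := sum_nodalWeight_erase_sub hinj f (a := m) (by simp)
    have h2 := sum_nodalWeight_erase_sub hinj f (a := m + (n + 1)) (by simp)
    rw [e1, ih (m + 1) (by omega)] at h1
    rw [e2, ih m (by omega)] at h2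
    have hne : θ (m + n + 1) - θ m ≠ 0 :=
      sub_ne_zero.mpr fun h => by have := hθ _ _ (by omega) (by omega) h; omega
    apply mul_left_cancel₀ hne
    -- The two erased sums differ termwise by `(θ k - θ m) - (θ k - θ (m + n + 1))`, which does not
    -- depend on `k`.
    rw [hΦ m n (by omega), h1, h2, ← Finset.sum_sub_distrib, Finset.mul_sum]
    refine Finset.sum_congr rfl fun k _ => ?_
    rw [← Nat.add_assoc]
    ring

/-! ### The eigenvalue sequence -/

theorem theta_eq (q b c : ℂ) (M : ℕ) :
    theta q b c M = b * (q ^ 2) ^ M + c * ((q ^ 2) ^ M)⁻¹ := by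
  rw [theta, neg_mul, zpow_neg, zpow_mul]
  norm_cast

theorem theta_sub_theta {q : ℂ} (hq : q ≠ 0) (b c : ℂ) (M N : ℕ) :
    theta q b c M - theta q b c N =
      (((q ^ 2) ^ M)⁻¹ - ((q ^ 2) ^ N)⁻¹) * (c - b * (q ^ 2) ^ (M + N)) := by
  rw [theta_eq, theta_eq, pow_add]
  have h1 : (q ^ 2) ^ M ≠ 0 := by positivity
  have h2 : (q ^ 2) ^ N ≠ 0 := by positivity
  field_simp
  ring

/-- The factor of `subEntry` at `M + 1` in which numerator and denominator may coincide. -/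
def subFactor (d : ℕ) (q b c : ℂ) (M : ℕ) : ℂ :=
  if M + 1 = d then 1 else (c - b * (q ^ 2) ^ (M + 1 + d)) / (c - b * (q ^ 2) ^ (2 * M + 2))

/-- The factor of `superEntry` at `M + 1` in which numerator and denominator may coincide. -/
def superFactor (q b c : ℂ) (M : ℕ) : ℂ :=
  if M = 0 then 1 else (c - b * (q ^ 2) ^ M) / (c - b * (q ^ 2) ^ (2 * M))

theorem subEntry_succ {q : ℂ} (hq : q ≠ 0) (d : ℕ) (r₀ bx cx bY cY bz cz : ℂ) (M : ℕ) :
    subEntry d q r₀ bx cx bY cY (cz * q ^ (-2 * (d : ℤ))) (bz * q ^ (2 * (d : ℤ))) (M + 1) =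
      q ^ 2 / (q ^ 2) ^ d * (1 - (q ^ 2) ^ (M + 1)) * subFactor d q bx cx M *
        (bY * cz * r₀ * q⁻¹ + bx * (q ^ 2) ^ M) *
        (cx * bz * r₀ * (q ^ 2) ^ d * q⁻¹ + cY * (q ^ 2) ^ M) /
        (cx - bx * (q ^ 2) ^ (2 * M + 1)) := by
  have e1 : q ^ (2 - 2 * (d : ℤ)) = q ^ 2 / (q ^ 2) ^ d := by
    rw [zpow_sub₀ hq, zpow_mul]; norm_cast
  have e2 : q ^ (2 * ((M + 1 : ℕ) : ℤ)) = (q ^ 2) ^ (M + 1) := by rw [zpow_mul]; norm_cast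
  have e3 : q ^ (2 * ((M + 1 : ℕ) : ℤ) + 2 * (d : ℤ)) = (q ^ 2) ^ (M + 1 + d) := by
    rw [← mul_add, zpow_mul]; norm_cast
  have e4 : q ^ (4 * ((M + 1 : ℕ) : ℤ)) = (q ^ 2) ^ (2 * M + 2) := by
    rw [← pow_mul]; norm_cast; ring
  have e5 : q ^ (2 * (d : ℤ) - 1) = (q ^ 2) ^ d * q⁻¹ := by
    rw [zpow_sub₀ hq, zpow_mul, zpow_one, div_eq_mul_inv]; norm_cast
  have e6 : q ^ (2 * ((M + 1 : ℕ) : ℤ) - 2) = (q ^ 2) ^ M := by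
    rw [show 2 * ((M + 1 : ℕ) : ℤ) - 2 = 2 * M by push_cast; ring, zpow_mul]; norm_cast
  have e7 : q ^ (4 * ((M + 1 : ℕ) : ℤ) - 2) = (q ^ 2) ^ (2 * M + 1) := by
    rw [show 4 * ((M + 1 : ℕ) : ℤ) - 2 = 2 * ((2 * M + 1 : ℕ) : ℤ) by push_cast; ring, zpow_mul]
    norm_cast
  have e8 : q ^ (-2 * (d : ℤ)) = ((q ^ 2) ^ d)⁻¹ := by
    rw [neg_mul, zpow_neg, zpow_mul]; norm_cast
  have e9 : q ^ (2 * (d : ℤ)) = (q ^ 2) ^ d := by rw [zpow_mul]; norm_cast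
  have hd : (q ^ 2) ^ d ≠ 0 := by positivity
  rw [subEntry, e1, e2, e3, e4, e5, e6, e7, e8, e9, subFactor]
  congr 2
  · congr 2
    field_simp
  · ring

theorem superEntry_succ {q : ℂ} (hq : q ≠ 0) (d : ℕ) (r₀ bx cx bY cY bz cz : ℂ) (M : ℕ) :
    superEntry d q r₀ bx cx bY cY (cz * q ^ (-2 * (d : ℤ))) (bz * q ^ (2 * (d : ℤ))) (M + 1) =
      (1 - (q ^ 2) ^ M / (q ^ 2) ^ d) * superFactor q bx cx M *
        (cx + bY * cz * r₀ * (q ^ 2) ^ M * q) *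
        (cY + bx * bz * r₀ * (q ^ 2) ^ M * (q ^ 2) ^ d * q) /
        (cx - bx * (q ^ 2) ^ (2 * M + 1)) := by
  have e1 : q ^ (2 * ((M + 1 : ℕ) : ℤ) - 2 * (d : ℤ) - 2) = (q ^ 2) ^ M / (q ^ 2) ^ d := by
    rw [show 2 * ((M + 1 : ℕ) : ℤ) - 2 * (d : ℤ) - 2 = 2 * M - 2 * d by push_cast; ring,
      zpow_sub₀ hq, zpow_mul, zpow_mul]; norm_cast
  have e2 : q ^ (2 * ((M + 1 : ℕ) : ℤ) - 2) = (q ^ 2) ^ M := by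
    rw [show 2 * ((M + 1 : ℕ) : ℤ) - 2 = 2 * M by push_cast; ring, zpow_mul]; norm_cast
  have e3 : q ^ (4 * ((M + 1 : ℕ) : ℤ) - 4) = (q ^ 2) ^ (2 * M) := by
    rw [show 4 * ((M + 1 : ℕ) : ℤ) - 4 = 2 * ((2 * M : ℕ) : ℤ) by push_cast; ring, zpow_mul]
    norm_cast
  have e4 : q ^ (2 * ((M + 1 : ℕ) : ℤ) + 2 * (d : ℤ) - 1) = (q ^ 2) ^ M * (q ^ 2) ^ d * q := by
    rw [show 2 * ((M + 1 : ℕ) : ℤ) + 2 * (d : ℤ) - 1 = 2 * M + 2 * d + 1 by push_cast; ring,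
      zpow_add₀ hq, zpow_add₀ hq, zpow_mul, zpow_mul]; norm_cast; simp
  have e5 : q ^ (2 * ((M + 1 : ℕ) : ℤ) - 1) = (q ^ 2) ^ M * q := by
    rw [show 2 * ((M + 1 : ℕ) : ℤ) - 1 = 2 * M + 1 by push_cast; ring,
      zpow_add₀ hq, zpow_mul]; norm_cast; simp
  have e7 : q ^ (4 * ((M + 1 : ℕ) : ℤ) - 2) = (q ^ 2) ^ (2 * M + 1) := by
    rw [show 4 * ((M + 1 : ℕ) : ℤ) - 2 = 2 * ((2 * M + 1 : ℕ) : ℤ) by push_cast; ring, zpow_mul]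
    norm_cast
  have e8 : q ^ (-2 * (d : ℤ)) = ((q ^ 2) ^ d)⁻¹ := by
    rw [neg_mul, zpow_neg, zpow_mul]; norm_cast
  have e9 : q ^ (2 * (d : ℤ)) = (q ^ 2) ^ d := by rw [zpow_mul]; norm_cast
  have hd : (q ^ 2) ^ d ≠ 0 := by positivity
  rw [superEntry, e1, e2, e3, e4, e5, e7, e8, e9, superFactor]
  simp only [Nat.add_eq_right]
  congr 2
  · congr 2
    field_simp
  · ring

theorem subEntry_zero (d : ℕ) (q r₀ bx cx bY cY bz cz : ℂ) :
    subEntry d q r₀ bx cx bY cY bz cz 0 = 0 := by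
  simp [subEntry]

theorem superEntry_last (d : ℕ) (q r₀ bx cx bY cY bz cz : ℂ) :
    superEntry d q r₀ bx cx bY cY bz cz (d + 1) = 0 := by
  have : q ^ (2 * ((d + 1 : ℕ) : ℤ) - 2 * (d : ℤ) - 2) = 1 := by
    rw [show 2 * ((d + 1 : ℕ) : ℤ) - 2 * (d : ℤ) - 2 = 0 by push_cast; ring, zpow_zero]
  rw [superEntry, this]; simp

/-! ### Products of differences of eigenvalues -/

/-- `∏_{j ≠ M} (θ_M - θ_j)`, the product over `0 ≤ j ≤ d`. -/
def thetaWeight (d : ℕ) (q b c : ℂ) (M : ℕ) : ℂ :=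
  (∏ j ∈ Finset.range M, (theta q b c M - theta q b c j)) *
    ∏ j ∈ Finset.range (d - M), (theta q b c M - theta q b c (M + 1 + j))

theorem nodalWeight_theta (d : ℕ) (q b c : ℂ) {M : ℕ} (hM : M ≤ d) :
    Lagrange.nodalWeight (Finset.Icc 0 (0 + d)) (theta q b c) M = (thetaWeight d q b c M)⁻¹ := by
  have : (Finset.Icc 0 (0 + d)).erase M =
      (Finset.range M).disjUnion ((Finset.range (d - M)).map (addLeftEmbedding (M + 1))) (by
        rw [Finset.disjoint_left]
        simp only [Finset.mem_range, Finset.mem_map, addLeftEmbedding_apply, not_exists, not_and]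
        intros; omega) := by
    ext x
    simp only [Finset.mem_erase, Finset.mem_Icc, Finset.mem_disjUnion, Finset.mem_range,
      Finset.mem_map, addLeftEmbedding_apply]
    constructor
    · intro h
      rcases Nat.lt_or_ge x M with h' | h'
      · exact Or.inl h'
      · exact Or.inr ⟨x - (M + 1), by omega, by omega⟩
    · rintro (h | ⟨a, h, rfl⟩) <;> omega
  rw [Lagrange.nodalWeight, this, Finset.prod_disjUnion, Finset.prod_map, thetaWeight, mul_inv,
    Finset.prod_inv_distrib, Finset.prod_inv_distrib]
  rfl

/-- Consecutive weights share almost all factors. The surviving `c - b (q ^ 2) ^ k` are those of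
`superFactor` and `subFactor`, so the weights absorb these parts of the matrix entries. -/
theorem thetaWeight_succ {d : ℕ} {q b c : ℂ} (hq : q ≠ 0)
    (hG : ∀ k, 1 ≤ k → k < 2 * d → c - b * (q ^ 2) ^ k ≠ 0) {M : ℕ} (hM : M < d) :
    thetaWeight d q b c (M + 1) * superFactor q b c M * ((q ^ 2) ^ (d - M) - 1) =
      thetaWeight d q b c M * subFactor d q b c M * ((1 - (q ^ 2) ^ (M + 1)) * ((q ^ 2) ^ M)⁻¹) := by
  obtain ⟨e, rfl⟩ : ∃ e, d = M + 1 + e := ⟨d - M - 1, by omega⟩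
  have hd1 : M + 1 + e - M = e + 1 := by omega
  have hd2 : M + 1 + e - (M + 1) = e := by omega
  rw [thetaWeight, thetaWeight, hd1, hd2]
  simp only [theta_sub_theta hq, Finset.prod_mul_distrib]
  have ht : q ^ 2 ≠ 0 := by positivity
  set t := q ^ 2 with ht'
  let G : ℕ → ℂ := fun k => c - b * t ^ k
  have a1 : ∏ j ∈ Finset.range (M + 1), ((t ^ (M + 1))⁻¹ - (t ^ j)⁻¹) =
      ((t ^ (M + 1))⁻¹ - 1) * (t ^ M)⁻¹ * ∏ j ∈ Finset.range M, ((t ^ M)⁻¹ - (t ^ j)⁻¹) := by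
    rw [Finset.prod_range_succ', pow_zero, inv_one, mul_assoc, mul_comm]
    congr 1
    trans ∏ j ∈ Finset.range M, t⁻¹ * ((t ^ M)⁻¹ - (t ^ j)⁻¹)
    · refine Finset.prod_congr rfl fun j _ => ?_
      rw [pow_succ, pow_succ, mul_inv, mul_inv]; ring
    · simp [Finset.prod_mul_distrib]
  have a2 : t ^ e * ∏ j ∈ Finset.range e, ((t ^ (M + 1))⁻¹ - (t ^ (M + 1 + 1 + j))⁻¹) =
      ∏ j ∈ Finset.range e, ((t ^ M)⁻¹ - (t ^ (M + 1 + j))⁻¹) := by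
    trans ∏ j ∈ Finset.range e, t * ((t ^ (M + 1))⁻¹ - (t ^ (M + 1 + 1 + j))⁻¹)
    · simp [Finset.prod_mul_distrib]
    refine Finset.prod_congr rfl fun j _ => ?_
    rw [show M + 1 + 1 + j = M + 1 + j + 1 by ring, pow_succ, pow_succ t (M + 1 + j), mul_inv,
      mul_inv]
    field_simp
  have a3 : ∏ j ∈ Finset.range (e + 1), ((t ^ M)⁻¹ - (t ^ (M + 1 + j))⁻¹) =
      (∏ j ∈ Finset.range e, ((t ^ M)⁻¹ - (t ^ (M + 1 + j))⁻¹)) *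
        ((t ^ M)⁻¹ - (t ^ (M + 1 + e))⁻¹) := Finset.prod_range_succ _ _
  -- The index ranges M+1..2M+1 and M..2M-1 overlap. What is left over is G(2M) G(2M+1) / G(M), and
  -- `superFactor` is G(M) / G(2M).
  have b1 : (∏ j ∈ Finset.range (M + 1), G (M + 1 + j)) * superFactor q b c M =
      (∏ j ∈ Finset.range M, G (M + j)) * G (2 * M + 1) := by
    rw [superFactor, ← ht']
    split_ifs with h
    · subst h; simp
    · obtain ⟨N, rfl⟩ : ∃ N, M = N + 1 := ⟨M - 1, by omega⟩
      rw [Finset.prod_range_succ, Finset.prod_range_succ, Finset.prod_range_succ' (fun j => G _)]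
      have hne := hG (2 * (N + 1)) (by omega) (by omega)
      have e1 : G (N + 1 + 1 + N) = c - b * t ^ (2 * (N + 1)) := by
        simp only [G]; congr 3; ring
      have e2 : G (N + 1 + 1 + (N + 1)) = G (2 * (N + 1) + 1) := by
        congr 1; ring
      have e3 : G (N + 1 + 0) = c - b * t ^ (N + 1) := rfl
      have e4 : ∏ j ∈ Finset.range N, G (N + 1 + (j + 1)) =
          ∏ j ∈ Finset.range N, G (N + 1 + 1 + j) :=
        Finset.prod_congr rfl fun j _ => by congr 1; ring
      rw [e1, e2, e3, e4]
      field_simp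
  have b2 : (∏ j ∈ Finset.range e, G (M + 1 + (M + 1 + 1 + j))) * G (2 * M + 1) =
      (∏ j ∈ Finset.range (e + 1), G (M + (M + 1 + j))) * subFactor (M + 1 + e) q b c M := by
    rw [subFactor, ← ht']
    split_ifs with h
    · obtain rfl : e = 0 := by omega
      simp only [Finset.prod_range_zero, zero_add, Finset.prod_range_one, one_mul, mul_one]
      congr 1; ring
    · obtain ⟨N, rfl⟩ : ∃ N, e = N + 1 := ⟨e - 1, by omega⟩
      rw [Finset.prod_range_succ, Finset.prod_range_succ', Finset.prod_range_succ' (fun j => G _)]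
      have hne := hG (2 * M + 2) (by omega) (by omega)
      have e1 : G (M + (M + 1 + (0 + 1))) = c - b * t ^ (2 * M + 2) := by
        simp only [G]; congr 3; ring
      have e2 : G (M + (M + 1 + 0)) = G (2 * M + 1) := by congr 1; ring
      have e3 : G (M + 1 + (M + 1 + 1 + N)) = c - b * t ^ (M + 1 + (M + 1 + (N + 1))) := by
        simp only [G]; congr 3; ring
      have e4 : ∏ j ∈ Finset.range N, G (M + (M + 1 + (j + 1 + 1))) =
          ∏ j ∈ Finset.range N, G (M + 1 + (M + 1 + 1 + j)) :=
        Finset.prod_congr rfl fun j _ => by congr 1; ring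
      rw [e1, e2, e3, e4]
      field_simp
  have hGne : G (2 * M + 1) ≠ 0 := hG _ (by omega) (by omega)
  apply mul_right_cancel₀ hGne
  have h3 : (t ^ (e + 1) - 1) = ((t ^ M)⁻¹ - (t ^ (M + 1 + e))⁻¹) * t ^ e * t ^ (M + 1) := by
    have h4 : t ^ M ≠ 0 := by positivity
    have h5 : t ^ e ≠ 0 := by positivity
    rw [pow_add, pow_add, pow_one, pow_add, pow_one]
    field_simp
  have h6 : 1 - t ^ (M + 1) = ((t ^ (M + 1))⁻¹ - 1) * t ^ (M + 1) := by
    have : t ^ (M + 1) ≠ 0 := by positivity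
    field_simp
  rw [a1, a3, ← a2, h3, h6]
  have b1' : (∏ j ∈ Finset.range (M + 1), (c - b * t ^ (M + 1 + j))) * superFactor q b c M =
      (∏ j ∈ Finset.range M, (c - b * t ^ (M + j))) * G (2 * M + 1) := b1
  have b2' : (∏ j ∈ Finset.range e, (c - b * t ^ (M + 1 + (M + 1 + 1 + j)))) * G (2 * M + 1) =
      (∏ j ∈ Finset.range (e + 1), (c - b * t ^ (M + (M + 1 + j)))) *
        subFactor (M + 1 + e) q b c M := b2
  generalize (∏ j ∈ Finset.range (M + 1), (c - b * t ^ (M + 1 + j))) = p1 at *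
  generalize (∏ j ∈ Finset.range M, (c - b * t ^ (M + j))) = p2 at *
  generalize (∏ j ∈ Finset.range e, (c - b * t ^ (M + 1 + (M + 1 + 1 + j)))) = p3 at *
  generalize (∏ j ∈ Finset.range (e + 1), (c - b * t ^ (M + (M + 1 + j)))) = p4 at *
  generalize (∏ j ∈ Finset.range M, ((t ^ M)⁻¹ - (t ^ j)⁻¹)) = p5
  generalize (∏ j ∈ Finset.range e, ((t ^ (M + 1))⁻¹ - (t ^ (M + 1 + 1 + j))⁻¹)) = p6
  generalize G (2 * M + 1) = g at *
  generalize superFactor q b c M = s1 at *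
  generalize subFactor (M + 1 + e) q b c M = s2 at *
  generalize (t ^ (M + 1))⁻¹ = i1
  generalize (t ^ M)⁻¹ = i2
  generalize (t ^ (M + 1 + e))⁻¹ = i3
  generalize t ^ (M + 1) = i4
  generalize t ^ e = i5
  linear_combination (i1 - 1) * i2 * p5 * p6 * (i2 - i3) * i5 * i4 * (p3 * g * b1' + p2 * g * b2')


/-! ### Factorized matrix entries

The parameters of the three maps are `(ba, ca)`, `(bb, cb)`, `(bc, cc)`, and everything is expressed in
the eigenbasis of the second map. -/

/-- The matrix entries below the diagonal of the first map in the eigenbasis of the second one. -/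
def lowEntry (d : ℕ) (q r₀ ba ca bb cb bc cc : ℂ) (M : ℕ) : ℂ :=
  subEntry d q r₀ bb cb ba ca (cc * q ^ (-2 * (d : ℤ))) (bc * q ^ (2 * (d : ℤ))) M

/-- The matrix entries above the diagonal of the first map in the eigenbasis of the second one. -/
def highEntry (d : ℕ) (q r₀ ba ca bb cb bc cc : ℂ) (M : ℕ) : ℂ :=
  superEntry d q r₀ bb cb ba ca (cc * q ^ (-2 * (d : ℤ))) (bc * q ^ (2 * (d : ℤ))) M

/-- The diagonal matrix entries of the first map in the eigenbasis of the second one. -/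
def diagEntry (d : ℕ) (q r₀ ba ca bb cb bc cc : ℂ) (M : ℕ) : ℂ :=
  theta q ba ca 0 - highEntry d q r₀ ba ca bb cb bc cc (M + 1)
    - lowEntry d q r₀ ba ca bb cb bc cc M

/-- The numerator of the ratio `g_{M+1} / g_M`. -/
def ratioNum (q r₀ ca cb bc : ℂ) (M : ℕ) : ℂ := cb + r₀ * ca * bc * q * (q ^ 2) ^ M

/-- The denominator of the ratio `g_{M+1} / g_M`. -/
def ratioDen (q r₀ ca bb bc : ℂ) (M : ℕ) : ℂ := r₀ * ca * bc + bb * q * (q ^ 2) ^ M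

/-- The remaining factor of the entry below the diagonal. -/
def lowFactor (d : ℕ) (q r₀ ca cb bc : ℂ) (M : ℕ) : ℂ :=
  ca + r₀ * bc * cb * (q ^ 2) ^ d / (q * (q ^ 2) ^ M)

/-- The remaining factor of the entry above the diagonal. -/
def highFactor (d : ℕ) (q r₀ ca bb bc : ℂ) (M : ℕ) : ℂ :=
  ca + r₀ * bc * bb * q * (q ^ 2) ^ M * (q ^ 2) ^ d

/-- The ratio `g_{M+1} / g_M`. -/
def gStep (q r₀ ca bb cb bc : ℂ) (M : ℕ) : ℂ :=
  (q ^ 2) ^ M * q * (bb / cb) * (ratioNum q r₀ ca cb bc M / ratioDen q r₀ ca bb bc M)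

section

variable {d : ℕ} {q r₀ ba ca bb cb bc cc : ℂ}

/-- The three parameter relations give `ba * cc * r₀ = bb * cb / (r₀ * ca * bc)`. This exhibits the
numerator of g_{M+1}/g_M as a factor of the lower entry; likewise the denominator is a factor of the
upper entry in `highEntry_succ`. Irreducibility therefore makes these ratios finite and nonzero. -/
theorem lowEntry_succ (hq : q ≠ 0) (hr : r₀ ≠ 0) (ha : ba * ca = (r₀ ^ 2)⁻¹)
    (hb : bb * cb = (r₀ ^ 2)⁻¹) (hc : bc * cc = (r₀ ^ 2)⁻¹) (M : ℕ) :
    lowEntry d q r₀ ba ca bb cb bc cc (M + 1) =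
      q ^ 2 / (q ^ 2) ^ d * (1 - (q ^ 2) ^ (M + 1)) * subFactor d q bb cb M *
        (bb / (r₀ * ca * bc * q) * ratioNum q r₀ ca cb bc M) *
        ((q ^ 2) ^ M * lowFactor d q r₀ ca cb bc M) / (cb - bb * (q ^ 2) ^ (2 * M + 1)) := by
  have hr2 : (r₀ ^ 2)⁻¹ ≠ 0 := by positivity
  have hca : ca ≠ 0 := right_ne_zero_of_mul (ha ▸ hr2)
  have hbc : bc ≠ 0 := left_ne_zero_of_mul (hc ▸ hr2)
  rw [lowEntry, subEntry_succ hq]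
  congr 2
  · congr 1
    have e : ba * cc * r₀ = bb * cb / (r₀ * ca * bc) := by
      rw [eq_div_iff (by positivity)]
      linear_combination r₀ ^ 2 * bc * cc * ha + r₀ ^ 2 * (r₀ ^ 2)⁻¹ * hc - hb
        + (r₀ ^ 2)⁻¹ * mul_inv_cancel₀ (pow_ne_zero 2 hr)
    rw [e, ratioNum]
    field_simp
  · rw [lowFactor]
    have : (q ^ 2) ^ M ≠ 0 := by positivity
    field_simp
    ring

theorem highEntry_succ (hq : q ≠ 0) (hr : r₀ ≠ 0) (ha : ba * ca = (r₀ ^ 2)⁻¹)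
    (hb : bb * cb = (r₀ ^ 2)⁻¹) (hc : bc * cc = (r₀ ^ 2)⁻¹) (M : ℕ) :
    highEntry d q r₀ ba ca bb cb bc cc (M + 1) =
      (1 - (q ^ 2) ^ M / (q ^ 2) ^ d) * superFactor q bb cb M *
        (cb / (r₀ * ca * bc) * ratioDen q r₀ ca bb bc M) *
        highFactor d q r₀ ca bb bc M / (cb - bb * (q ^ 2) ^ (2 * M + 1)) := by
  have hr2 : (r₀ ^ 2)⁻¹ ≠ 0 := by positivity
  have hca : ca ≠ 0 := right_ne_zero_of_mul (ha ▸ hr2)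
  have hbc : bc ≠ 0 := left_ne_zero_of_mul (hc ▸ hr2)
  rw [highEntry, superEntry_succ hq]
  congr 2
  · congr 1
    have e : ba * cc * r₀ = bb * cb / (r₀ * ca * bc) := by
      rw [eq_div_iff (by positivity)]
      linear_combination r₀ ^ 2 * bc * cc * ha + r₀ ^ 2 * (r₀ ^ 2)⁻¹ * hc - hb
        + (r₀ ^ 2)⁻¹ * mul_inv_cancel₀ (pow_ne_zero 2 hr)
    rw [e, ratioDen]
    field_simp
  · rw [highFactor]
    ring

/-! ### The third map in the eigenbasis of the second one, and its eigenvector with coefficients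
g_M. -/

/-- The additive constant in `A^c = r₀ / (q² - q⁻²) [A^b, A^a]_q + const`. -/
def thirdConst (d : ℕ) (q r₀ ba ca bb cb bc cc : ℂ) : ℂ :=
  -(r₀ / (q + q⁻¹)) * (thetaMid d q ba ca * thetaMid d q bb cb
    - r₀⁻¹ * (q ^ d * q + (q ^ d * q)⁻¹) * thetaMid d q bc cc)

/-- Matrix entries of the third map below the diagonal in the eigenbasis of the second one. -/
def thirdLow (d : ℕ) (q r₀ ba ca bb cb bc cc : ℂ) (M : ℕ) : ℂ :=
  r₀ * bb * (q ^ 2) ^ M * q⁻¹ * lowEntry d q r₀ ba ca bb cb bc cc M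

/-- Matrix entries of the third map above the diagonal in the eigenbasis of the second one. -/
def thirdHigh (d : ℕ) (q r₀ ba ca bb cb bc cc : ℂ) (M : ℕ) : ℂ :=
  r₀ * cb * q * ((q ^ 2) ^ M)⁻¹ * highEntry d q r₀ ba ca bb cb bc cc M

/-- Diagonal matrix entries of the third map in the eigenbasis of the second one. -/
def thirdDiag (d : ℕ) (q r₀ ba ca bb cb bc cc : ℂ) (M : ℕ) : ℂ :=
  r₀ / (q + q⁻¹) * theta q bb cb M * diagEntry d q r₀ ba ca bb cb bc cc M
    + thirdConst d q r₀ ba ca bb cb bc cc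

/-- The superdiagonal term of row `M` is paired with the contribution of `-highEntry` to the
diagonal. Only in this combination does the denominator `cb - bb * (q ^ 2) ^ (2 * M + 1)` cancel. -/
theorem third_up (hq : q ≠ 0) (hq2 : q ^ 2 + 1 ≠ 0) (hr : r₀ ≠ 0) (ha : ba * ca = (r₀ ^ 2)⁻¹)
    (hb : bb * cb = (r₀ ^ 2)⁻¹) (hc : bc * cc = (r₀ ^ 2)⁻¹)
    (hG : ∀ k, 1 ≤ k → k < 2 * d → cb - bb * (q ^ 2) ^ k ≠ 0)
    (hZ : ∀ k < d, ratioDen q r₀ ca bb bc k ≠ 0) (g : ℕ → ℂ)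
    (hg : ∀ k < d, g (k + 1) = g k * gStep q r₀ ca bb cb bc k) (M : ℕ) (hM : M ≤ d) :
    (if M = d then 0 else thirdHigh d q r₀ ba ca bb cb bc cc (M + 1) * g (M + 1))
      - r₀ / (q + q⁻¹) * theta q bb cb M * highEntry d q r₀ ba ca bb cb bc cc (M + 1) * g M =
    g M * (r₀ / (q + q⁻¹)) * (-(cb / (r₀ * ca * bc)) * (1 - (q ^ 2) ^ M / (q ^ 2) ^ d) *
      superFactor q bb cb M * highFactor d q r₀ ca bb bc M *
      (r₀ * ca * bc / (q ^ 2) ^ M - bb / q)) := by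
  have hr2 : (r₀ ^ 2)⁻¹ ≠ 0 := by positivity
  have hca : ca ≠ 0 := right_ne_zero_of_mul (ha ▸ hr2)
  have hbc : bc ≠ 0 := left_ne_zero_of_mul (hc ▸ hr2)
  have hcb : cb ≠ 0 := right_ne_zero_of_mul (hb ▸ hr2)
  have ht : (q ^ 2) ^ M ≠ 0 := by positivity
  rw [highEntry_succ hq hr ha hb hc]
  rcases eq_or_ne M d with rfl | hne
  · rw [if_pos rfl, div_self ht]; simp
  rw [if_neg hne, thirdHigh, highEntry_succ hq hr ha hb hc, hg M (by omega), gStep, theta_eq]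
  have hGM := hG (2 * M + 1) (by omega) (by omega)
  have hZM := hZ M (by omega)
  have hqq : q + q⁻¹ ≠ 0 := by
    intro h; apply hq2; field_simp at h; simpa using h
  have e1 : ratioNum q r₀ ca cb bc M = cb + r₀ * ca * bc * q * (q ^ 2) ^ M := rfl
  have e2 : ratioDen q r₀ ca bb bc M = r₀ * ca * bc + bb * q * (q ^ 2) ^ M := rfl
  have e3 : (q ^ 2) ^ (2 * M + 1) = q ^ 2 * ((q ^ 2) ^ M) ^ 2 := by ring
  have e4 : (q ^ 2) ^ (M + 1) = q ^ 2 * (q ^ 2) ^ M := by ring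
  rw [e3] at hGM ⊢
  rw [e4, e1]
  generalize superFactor q bb cb M = β
  generalize highFactor d q r₀ ca bb bc M = z
  generalize (1 - (q ^ 2) ^ M / (q ^ 2) ^ d) = w
  generalize hZ' : ratioDen q r₀ ca bb bc M = Z at *
  generalize (q ^ 2) ^ M = m at *
  generalize g M = g0
  have hGM' : cb - q ^ 2 * bb * m ^ 2 ≠ 0 := by convert hGM using 1; ring
  trans g0 * (r₀ / (q + q⁻¹)) * (w * β * z / (cb - bb * (q ^ 2 * m ^ 2))) *
      ((cb / (r₀ * ca * bc)) * ((q + q⁻¹) * bb * (cb + r₀ * ca * bc * q * m)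
        - (bb * m + cb * m⁻¹) * Z))
  · field_simp
  · rw [e2]
    -- The bracket is divisible by the denominator that has to disappear.
    have : (q + q⁻¹) * bb * (cb + r₀ * ca * bc * q * m)
        - (bb * m + cb * m⁻¹) * (r₀ * ca * bc + bb * q * m) =
        (cb - bb * (q ^ 2 * m ^ 2)) * (-(r₀ * ca * bc / m - bb / q)) := by
      field_simp
      ring
    rw [this]
    generalize r₀ * ca * bc / m - bb / q = E
    field_simp

/-- Counterpart of `third_up` for the subdiagonal term and the `-lowEntry` part of the diagonal.
Here `g M` is expressed through `g (M + 1)`, which needs `ratioNum` to be nonzero. -/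
theorem third_down (hq : q ≠ 0) (hq2 : q ^ 2 + 1 ≠ 0) (hr : r₀ ≠ 0) (ha : ba * ca = (r₀ ^ 2)⁻¹)
    (hb : bb * cb = (r₀ ^ 2)⁻¹) (hc : bc * cc = (r₀ ^ 2)⁻¹)
    (hG : ∀ k, 1 ≤ k → k < 2 * d → cb - bb * (q ^ 2) ^ k ≠ 0)
    (hU : ∀ k < d, ratioNum q r₀ ca cb bc k ≠ 0)
    (hZ : ∀ k < d, ratioDen q r₀ ca bb bc k ≠ 0) (g : ℕ → ℂ)
    (hg : ∀ k < d, g (k + 1) = g k * gStep q r₀ ca bb cb bc k) (M : ℕ) (hM : M < d) :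
    thirdLow d q r₀ ba ca bb cb bc cc (M + 1) * g M
      - r₀ / (q + q⁻¹) * theta q bb cb (M + 1) * lowEntry d q r₀ ba ca bb cb bc cc (M + 1)
        * g (M + 1) =
    g (M + 1) * (r₀ / (q + q⁻¹)) * (bb / (r₀ * ca * bc) * (1 - (q ^ 2) ^ (M + 1)) *
      subFactor d q bb cb M * (q ^ 2) ^ (M + 1) / (q ^ 2) ^ d * lowFactor d q r₀ ca cb bc M *
      (r₀ * ca * bc * q - cb / (q ^ 2) ^ (M + 1)) / q) := by
  have hr2 : (r₀ ^ 2)⁻¹ ≠ 0 := by positivity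
  have hca : ca ≠ 0 := right_ne_zero_of_mul (ha ▸ hr2)
  have hbc : bc ≠ 0 := left_ne_zero_of_mul (hc ▸ hr2)
  have hcb : cb ≠ 0 := right_ne_zero_of_mul (hb ▸ hr2)
  have hbb : bb ≠ 0 := left_ne_zero_of_mul (hb ▸ hr2)
  have ht : (q ^ 2) ^ M ≠ 0 := by positivity
  have hd : (q ^ 2) ^ d ≠ 0 := by positivity
  rw [thirdLow, lowEntry_succ hq hr ha hb hc, hg M (by omega), gStep, theta_eq]
  have hGM := hG (2 * M + 1) (by omega) (by omega)
  have hZM := hZ M (by omega)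
  have hUM := hU M (by omega)
  have hqq : q + q⁻¹ ≠ 0 := by
    intro h; apply hq2; field_simp at h; simpa using h
  have e1 : ratioNum q r₀ ca cb bc M = cb + r₀ * ca * bc * q * (q ^ 2) ^ M := rfl
  have e2 : ratioDen q r₀ ca bb bc M = r₀ * ca * bc + bb * q * (q ^ 2) ^ M := rfl
  have e3 : (q ^ 2) ^ (2 * M + 1) = q ^ 2 * ((q ^ 2) ^ M) ^ 2 := by ring
  have e4 : (q ^ 2) ^ (M + 1) = q ^ 2 * (q ^ 2) ^ M := by ring
  rw [e3] at hGM ⊢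
  rw [e4]
  generalize subFactor d q bb cb M = α
  generalize lowFactor d q r₀ ca cb bc M = y
  generalize (1 - q ^ 2 * (q ^ 2) ^ M) = w
  generalize hZ' : ratioDen q r₀ ca bb bc M = Z at *
  generalize hU' : ratioNum q r₀ ca cb bc M = U at *
  generalize (q ^ 2) ^ M = m at *
  generalize (q ^ 2) ^ d = p at *
  generalize g M = g0
  have hGM' : cb - q ^ 2 * bb * m ^ 2 ≠ 0 := by convert hGM using 1; ring
  trans g0 * (r₀ / (q + q⁻¹)) * (w * α * y / (cb - bb * (q ^ 2 * m ^ 2))) *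
      (q * m ^ 2 * bb / (p * (r₀ * ca * bc))) * q * (bb / cb) * (U / Z) *
      ((q + q⁻¹) * cb * Z  - (bb * q ^ 2 * m + cb * (q ^ 2 * m)⁻¹) * U)
  · field_simp
  · have : (q + q⁻¹) * cb * Z - (bb * q ^ 2 * m + cb * (q ^ 2 * m)⁻¹) * U =
        (cb - bb * (q ^ 2 * m ^ 2)) * (r₀ * ca * bc * q - cb / (q ^ 2 * m)) := by
      rw [e1, e2]
      field_simp
      ring
    rw [this]
    generalize r₀ * ca * bc * q - cb / (q ^ 2 * m) = E
    field_simp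

end


/-- This is what remains of row `M` of the eigenvalue equation after the cancellations in `third_up`
and `third_down`, with m = q^{2M} and s = q^d. The alternatives are the first row, the last row and
an interior row. In the first row `1 - m` kills the term with `α`; in the last row `1 - m / s ^ 2`
kills the term with `β`. -/
theorem third_identity {q r₀ ba ca bb cb bc cc m s α β : ℂ} (hq : q ≠ 0) (hr : r₀ ≠ 0)
    (ha : ba * ca = (r₀ ^ 2)⁻¹) (hb : bb * cb = (r₀ ^ 2)⁻¹) (hc : bc * cc = (r₀ ^ 2)⁻¹)
    (hm : m ≠ 0) (hs : s ≠ 0)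
    (h : m = 1 ∧ β = 1 ∨ m = s ^ 2 ∧ α = 1 ∨
      cb - bb * m ^ 2 ≠ 0 ∧ β = (cb - bb * m) / (cb - bb * m ^ 2) ∧
        α = (cb - bb * (m * s ^ 2)) / (cb - bb * m ^ 2)) :
    -(cb / (r₀ * ca * bc)) * (1 - m / s ^ 2) * β * (ca + r₀ * bc * bb * q * m * s ^ 2) *
        (r₀ * ca * bc / m - bb / q)
      + bb / (r₀ * ca * bc) * (1 - m) * α * m / s ^ 2 * (ca + r₀ * bc * cb * s ^ 2 * q / m) *
        (r₀ * ca * bc * q - cb / m) / q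
      + (bb * m + cb * m⁻¹) * (ba + ca)
      - ((ba * s + ca * s⁻¹) * (bb * s + cb * s⁻¹)
        - r₀⁻¹ * (s * q + (s * q)⁻¹) * (bc * s + cc * s⁻¹))
      - (q + q⁻¹) / r₀ * (bc + cc) = 0 := by
  have hr2 : (r₀ ^ 2)⁻¹ ≠ 0 := by positivity
  have hca : ca ≠ 0 := right_ne_zero_of_mul (ha ▸ hr2)
  have hbc : bc ≠ 0 := left_ne_zero_of_mul (hc ▸ hr2)
  have hbb : bb ≠ 0 := left_ne_zero_of_mul (hb ▸ hr2)
  obtain rfl : ba = (r₀ ^ 2 * ca)⁻¹ := by rw [mul_inv, ← ha]; field_simp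
  obtain rfl : cb = (r₀ ^ 2 * bb)⁻¹ := by rw [mul_inv, ← hb]; field_simp
  obtain rfl : cc = (r₀ ^ 2 * bc)⁻¹ := by rw [mul_inv, ← hc]; field_simp
  rcases h with ⟨rfl, rfl⟩ | ⟨rfl, rfl⟩ | ⟨hD, rfl, rfl⟩
  · field_simp
    ring
  · field_simp
    ring
  · have hD' : 1 - r₀ ^ 2 * bb ^ 2 * m ^ 2 ≠ 0 := by
      intro h0; apply hD; field_simp; linear_combination h0
    have e0 : (r₀ ^ 2 * bb)⁻¹ - bb * m ^ 2 = (1 - r₀ ^ 2 * bb ^ 2 * m ^ 2) / (r₀ ^ 2 * bb) := by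
      field_simp
    rw [e0]
    field_simp
    ring

section

variable {d : ℕ} {q r₀ ba ca bb cb bc cc : ℂ}

theorem third_mul_ratio (hq : q ≠ 0) (hq2 : q ^ 2 + 1 ≠ 0) (hr : r₀ ≠ 0)
    (ha : ba * ca = (r₀ ^ 2)⁻¹) (hb : bb * cb = (r₀ ^ 2)⁻¹) (hc : bc * cc = (r₀ ^ 2)⁻¹)
    (hG : ∀ k, 1 ≤ k → k < 2 * d → cb - bb * (q ^ 2) ^ k ≠ 0)
    (hU : ∀ k < d, ratioNum q r₀ ca cb bc k ≠ 0)
    (hZ : ∀ k < d, ratioDen q r₀ ca bb bc k ≠ 0) (g : ℕ → ℂ)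
    (hg : ∀ k < d, g (k + 1) = g k * gStep q r₀ ca bb cb bc k) (M : ℕ) (hM : M ≤ d) :
    (if M = 0 then 0 else thirdLow d q r₀ ba ca bb cb bc cc M * g (M - 1))
      + thirdDiag d q r₀ ba ca bb cb bc cc M * g M
      + (if M = d then 0 else thirdHigh d q r₀ ba ca bb cb bc cc (M + 1) * g (M + 1)) =
    theta q bc cc 0 * g M := by
  have hqq : q + q⁻¹ ≠ 0 := by
    intro h; apply hq2; field_simp at h; simpa using h
  have hsd : (q ^ 2) ^ d = (q ^ d) ^ 2 := by ring
  have hs : q ^ d ≠ 0 := by positivity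
  have hup := third_up hq hq2 hr ha hb hc hG hZ g hg M hM
  have hd : ∀ M, thirdDiag d q r₀ ba ca bb cb bc cc M = r₀ / (q + q⁻¹) * (theta q bb cb M *
      (theta q ba ca 0 - highEntry d q r₀ ba ca bb cb bc cc (M + 1)
        - lowEntry d q r₀ ba ca bb cb bc cc M)
      - ((ba * q ^ d + ca * (q ^ d)⁻¹) * (bb * q ^ d + cb * (q ^ d)⁻¹)
        - r₀⁻¹ * (q ^ d * q + (q ^ d * q)⁻¹) * (bc * q ^ d + cc * (q ^ d)⁻¹))) := by
    intro M
    simp only [thirdDiag, thirdConst, diagEntry, thetaMid, zpow_neg, zpow_natCast]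
    ring
  have h0 : ∀ b c, theta q b c 0 = b + c := by intro b c; simp [theta]
  rcases Nat.eq_zero_or_pos M with rfl | hpos
  -- The value of `α` is arbitrary here, since it is multiplied by `1 - m = 0`.
  · have key := third_identity (α := 1) hq hr ha hb hc (one_ne_zero) hs (Or.inl ⟨rfl, rfl⟩)
    have hlow : lowEntry d q r₀ ba ca bb cb bc cc 0 = 0 := subEntry_zero ..
    rw [if_pos rfl, hd, hlow]
    simp only [h0, highFactor, superFactor, if_true, pow_zero, hsd] at hup ⊢
    linear_combination hup + g 0 * (r₀ / (q + q⁻¹)) * key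
      + (bc + cc) * g 0 * (r₀ * r₀⁻¹ * mul_inv_cancel₀ hqq + mul_inv_cancel₀ hr)
  · obtain ⟨N, rfl⟩ : ∃ N, M = N + 1 := ⟨M - 1, by omega⟩
    have hdown := third_down hq hq2 hr ha hb hc hG hU hZ g hg N hM
    have hm : (q ^ 2) ^ (N + 1) ≠ 0 := by positivity
    have e1 : (q ^ 2) ^ (2 * N + 2) = ((q ^ 2) ^ (N + 1)) ^ 2 := by ring
    have e2 : (q ^ 2) ^ (N + 1 + d) = (q ^ 2) ^ (N + 1) * (q ^ d) ^ 2 := by ring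
    have key := third_identity (m := (q ^ 2) ^ (N + 1)) (s := q ^ d)
      (α := subFactor d q bb cb N) (β := superFactor q bb cb (N + 1)) hq hr ha hb hc hm hs (by
        by_cases hNd : N + 1 = d
        · right; left
          exact ⟨by rw [hNd]; ring, by rw [subFactor, if_pos hNd]⟩
        · right; right
          refine ⟨?_, ?_, ?_⟩
          · rw [← e1]; exact hG _ (by omega) (by omega)
          · rw [superFactor, if_neg (by omega), show 2 * (N + 1) = 2 * N + 2 by ring, e1]
          · rw [subFactor, if_neg hNd, e1, e2])
    have e3 : lowFactor d q r₀ ca cb bc N =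
        ca + r₀ * bc * cb * (q ^ d) ^ 2 * q / (q ^ 2) ^ (N + 1) := by
      rw [lowFactor, hsd, pow_succ (q ^ 2) N]
      have : (q ^ 2) ^ N ≠ 0 := by positivity
      field_simp
    rw [if_neg (by omega), hd, Nat.add_sub_cancel]
    rw [e3, hsd] at hdown
    simp only [h0, highFactor, hsd] at hup ⊢
    rw [theta_eq] at hup hdown ⊢
    linear_combination hup + hdown + g (N + 1) * (r₀ / (q + q⁻¹)) * key
      + (bc + cc) * g (N + 1) * (r₀ * r₀⁻¹ * mul_inv_cancel₀ hqq + mul_inv_cancel₀ hr)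

/-! ### Summation -/

/-- In the Casoratian relation the ratio g_{M+1}/g_M cancels `ratioNum` and `ratioDen`. The factors
1 - q^{2k} and the sub- and superfactors are absorbed by `thetaWeight_succ`. Only `lowFactor` and
`highFactor` survive, up to elementary factors. -/
theorem weight_recursion (hq : q ≠ 0) (hqd : ∀ k, 0 < k → (q ^ 2) ^ k ≠ 1) (hr : r₀ ≠ 0)
    (ha : ba * ca = (r₀ ^ 2)⁻¹) (hb : bb * cb = (r₀ ^ 2)⁻¹) (hc : bc * cc = (r₀ ^ 2)⁻¹)
    (hG : ∀ k, 1 ≤ k → k < 2 * d → cb - bb * (q ^ 2) ^ k ≠ 0)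
    (hU : ∀ k < d, ratioNum q r₀ ca cb bc k ≠ 0)
    (hZ : ∀ k < d, ratioDen q r₀ ca bb bc k ≠ 0)
    (hlow : ∀ k < d, subFactor d q bb cb k ≠ 0) (hhigh : ∀ k < d, superFactor q bb cb k ≠ 0)
    (g n : ℕ → ℂ) (hg0 : ∀ k ≤ d, g k ≠ 0)
    (hg : ∀ k < d, g (k + 1) = g k * gStep q r₀ ca bb cb bc k)
    (M : ℕ) (hM : M < d)
    (hn : n (M + 1) * thirdLow d q r₀ ba ca bb cb bc cc (M + 1) * g M =
      n M * thirdHigh d q r₀ ba ca bb cb bc cc (M + 1) * g (M + 1)) :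
    n (M + 1) * thetaWeight d q bb cb (M + 1) *
        (bb * (q ^ 2) ^ (2 * M + 1) * lowFactor d q r₀ ca cb bc M) =
      n M * thetaWeight d q bb cb M * (cb * highFactor d q r₀ ca bb bc M) := by
  have hr2 : (r₀ ^ 2)⁻¹ ≠ 0 := by positivity
  have hca : ca ≠ 0 := right_ne_zero_of_mul (ha ▸ hr2)
  have hbc : bc ≠ 0 := left_ne_zero_of_mul (hc ▸ hr2)
  have hcb : cb ≠ 0 := right_ne_zero_of_mul (hb ▸ hr2)
  have hbb : bb ≠ 0 := left_ne_zero_of_mul (hb ▸ hr2)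
  have ht : (q ^ 2) ^ M ≠ 0 := by positivity
  have hd : (q ^ 2) ^ d ≠ 0 := by positivity
  have hw := thetaWeight_succ hq hG hM
  have hdM : (q ^ 2) ^ d = (q ^ 2) ^ M * (q ^ 2) ^ (d - M) := by rw [← pow_add]; congr 1; omega
  have hGM := hG (2 * M + 1) (by omega) (by omega)
  have hUM := hU M hM
  have hZM := hZ M hM
  have hgM := hg0 M (by omega)
  have hα := hlow M hM
  have hβ := hhigh M hM
  have h1 : 1 - (q ^ 2) ^ (M + 1) ≠ 0 := sub_ne_zero.mpr (hqd _ (by omega)).symm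
  have h2 : (q ^ 2) ^ (d - M) - 1 ≠ 0 := sub_ne_zero.mpr (hqd _ (by omega))
  rw [thirdLow, thirdHigh, lowEntry_succ hq hr ha hb hc, highEntry_succ hq hr ha hb hc, hg M hM,
    gStep] at hn
  have e1 : (q ^ 2) ^ (2 * M + 1) = q ^ 2 * ((q ^ 2) ^ M) ^ 2 := by ring
  have e4 : (q ^ 2) ^ (M + 1) = q ^ 2 * (q ^ 2) ^ M := by ring
  have hv : 1 - (q ^ 2) ^ M / (q ^ 2) ^ d =
      ((q ^ 2) ^ (d - M) - 1) * ((q ^ 2) ^ M / (q ^ 2) ^ d) := by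
    rw [hdM]
    have : (q ^ 2) ^ (d - M) ≠ 0 := by positivity
    field_simp
  rw [hv] at hn
  generalize ((q ^ 2) ^ (d - M) - 1) = v at *
  generalize hw' : (1 - (q ^ 2) ^ (M + 1)) = w at *
  rw [e4] at hn
  generalize hD : cb - bb * (q ^ 2) ^ (2 * M + 1) = D at *
  rw [e1]
  generalize ratioNum q r₀ ca cb bc M = U at *
  generalize ratioDen q r₀ ca bb bc M = Z at *
  generalize subFactor d q bb cb M = α at *
  generalize superFactor q bb cb M = β at *
  generalize lowFactor d q r₀ ca cb bc M = y at *
  generalize highFactor d q r₀ ca bb bc M = z at *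
  generalize thetaWeight d q bb cb M = W at *
  generalize thetaWeight d q bb cb (M + 1) = W' at *
  generalize (q ^ 2) ^ M = m at *
  generalize (q ^ 2) ^ d = p at *
  generalize n M = n0 at *
  generalize n (M + 1) = n1 at *
  generalize g M = g0 at *
  have hn' : n1 * (q ^ 2 * m * w * α * bb * y) = n0 * (v * β * cb * z) := by
    have hne : r₀ * bb * U * m * g0 / (r₀ * ca * bc * D * p) ≠ 0 := by positivity
    apply mul_left_cancel₀ hne
    convert hn using 1
    · field_simp
    · field_simp
  have hw2 : W' * β * v * m = W * α * w := by
    rw [hw]; field_simp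
  have hne : v * β * α * w ≠ 0 := by positivity
  apply mul_left_cancel₀ hne
  linear_combination W' * m * v * β * hn' + n0 * cb * z * v * β * hw2

/-- Dividing `n M * thetaWeight M` by the weight again turns the sum into the divided difference of
that sequence at the nodes θ_0, …, θ_d. Its first-order recursion is simple enough to make every
divided difference over consecutive nodes a product. -/
theorem sum_left_eigenvector (hq : q ≠ 0) (hqd : ∀ k, 0 < k → (q ^ 2) ^ k ≠ 1) (hr : r₀ ≠ 0)
    (hb : bb * cb = (r₀ ^ 2)⁻¹)
    (hθ : ∀ M N, M ≤ d → N ≤ d → theta q bb cb M = theta q bb cb N → M = N)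
    (hy : ∀ k < d, lowFactor d q r₀ ca cb bc k ≠ 0) (n : ℕ → ℂ)
    (hn : ∀ M < d, n (M + 1) * thetaWeight d q bb cb (M + 1) *
        (bb * (q ^ 2) ^ (2 * M + 1) * lowFactor d q r₀ ca cb bc M) =
      n M * thetaWeight d q bb cb M * (cb * highFactor d q r₀ ca bb bc M)) :
    ∑ M ∈ Finset.range (d + 1), n M = n 0 * thetaWeight d q bb cb 0 *
      ∏ j ∈ Finset.range d,
        (ca / (bb * (1 - (q ^ 2) ^ (j + 1)) * lowFactor d q r₀ ca cb bc j)) := by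
  have hr2 : (r₀ ^ 2)⁻¹ ≠ 0 := by positivity
  have hcb : cb ≠ 0 := right_ne_zero_of_mul (hb ▸ hr2)
  have hbb : bb ≠ 0 := left_ne_zero_of_mul (hb ▸ hr2)
  let y : ℕ → ℂ := lowFactor d q r₀ ca cb bc
  let f : ℕ → ℂ := fun M => n M * thetaWeight d q bb cb M
  let K : ℕ → ℂ := fun n => ∏ j ∈ Finset.range n, (ca / (bb * (1 - (q ^ 2) ^ (j + 1))))
  -- Closed form of the divided difference over the nodes θ_m, …, θ_{m+n}.
  let Φ : ℕ → ℕ → ℂ := fun m n =>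
    f m * K n * ((q ^ 2) ^ (m * n))⁻¹ / ∏ j ∈ Finset.range n, y (m + j)
  have hW : ∀ M ≤ d, thetaWeight d q bb cb M ≠ 0 := by
    intro M hM
    rw [thetaWeight]
    refine mul_ne_zero (Finset.prod_ne_zero_iff.mpr fun j hj => ?_)
      (Finset.prod_ne_zero_iff.mpr fun j hj => ?_)
    · rw [Finset.mem_range] at hj
      exact sub_ne_zero.mpr fun h => by have := hθ _ _ hM (by omega) h; omega
    · rw [Finset.mem_range] at hj
      exact sub_ne_zero.mpr fun h => by have := hθ _ _ hM (by omega) h; omega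
  have hrec := sum_nodalWeight_eq_of_recursion (d := d) (θ := theta q bb cb) (f := f) (Φ := Φ) hθ
    (by intro m; simp [Φ, K]) (by
      intro m n hmn
      have hprod : (∏ j ∈ Finset.range n, y (m + j)) * y (m + n) =
          y m * ∏ j ∈ Finset.range n, y (m + 1 + j) := by
        rw [← Finset.prod_range_succ (fun j => y (m + j)), Finset.prod_range_succ', mul_comm]
        congr 1
        exact Finset.prod_congr rfl fun j _ => by congr 1; ring
      have hy1 : ∏ j ∈ Finset.range n, y (m + j) ≠ 0 :=
        Finset.prod_ne_zero_iff.mpr fun j hj => hy _ (by rw [Finset.mem_range] at hj; omega)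
      have hy2 : ∏ j ∈ Finset.range n, y (m + 1 + j) ≠ 0 :=
        Finset.prod_ne_zero_iff.mpr fun j hj => hy _ (by rw [Finset.mem_range] at hj; omega)
      have hy3 : y (m + n) ≠ 0 := hy _ (by omega)
      have hy4 : y m ≠ 0 := hy _ (by omega)
      have hf : f (m + 1) * (bb * (q ^ 2) ^ (2 * m + 1) * y m) =
          f m * (cb * highFactor d q r₀ ca bb bc m) := hn m (by omega)
      have hK : K (n + 1) = K n * (ca / (bb * (1 - (q ^ 2) ^ (n + 1)))) :=
        Finset.prod_range_succ _ _
      have h1 : 1 - (q ^ 2) ^ (n + 1) ≠ 0 := sub_ne_zero.mpr (hqd _ (by omega)).symm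
      have hm : (q ^ 2) ^ m ≠ 0 := by positivity
      have hnn : (q ^ 2) ^ n ≠ 0 := by positivity
      have hmn' : (q ^ 2) ^ (m * n) ≠ 0 := by positivity
      have e1 : f (m + 1) = f m * (cb * highFactor d q r₀ ca bb bc m) /
          (bb * (q ^ 2) ^ (2 * m + 1) * y m) := by
        rw [← hf]; field_simp
      have e2 : y (m + n) = ca + r₀ * bc * cb * (q ^ 2) ^ d / (q * (q ^ 2) ^ (m + n)) := rfl
      have e3 : ∏ j ∈ Finset.range n, y (m + 1 + j) =
          (∏ j ∈ Finset.range n, y (m + j)) * y (m + n) / y m := by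
        rw [hprod]; field_simp
      simp only [Φ]
      rw [e1, e3, hK, Finset.prod_range_succ, theta_sub_theta hq, highFactor]
      generalize (∏ j ∈ Finset.range n, y (m + j)) = P at *
      generalize K n = k0
      generalize f m = f0
      generalize y m = y0 at *
      generalize hyn : y (m + n) = yn at *
      rw [show (q ^ 2) ^ (m + n + 1) = q ^ 2 * (q ^ 2) ^ m * (q ^ 2) ^ n by ring,
        show (q ^ 2) ^ (m + n + 1 + m) = q ^ 2 * ((q ^ 2) ^ m) ^ 2 * (q ^ 2) ^ n by ring,
        show (q ^ 2) ^ (m * (n + 1)) = (q ^ 2) ^ m * (q ^ 2) ^ (m * n) by ring,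
        show (q ^ 2) ^ ((m + 1) * n) = (q ^ 2) ^ n * (q ^ 2) ^ (m * n) by ring,
        show (q ^ 2) ^ (2 * m + 1) = q ^ 2 * ((q ^ 2) ^ m) ^ 2 by ring]
      rw [show (q ^ 2) ^ (n + 1) = q ^ 2 * (q ^ 2) ^ n by ring] at h1 ⊢
      rw [show (q ^ 2) ^ (m + n) = (q ^ 2) ^ m * (q ^ 2) ^ n by ring] at e2
      generalize (q ^ 2) ^ m = a at *
      generalize (q ^ 2) ^ n = b at *
      generalize (q ^ 2) ^ (m * n) = c at *
      generalize (q ^ 2) ^ d = p at *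
      trans f0 * k0 / (c * P * yn) * (ca * (cb - bb * (q ^ 2 * a ^ 2 * b)) / (bb * q ^ 2 * a ^ 2 * b))
      · field_simp
      -- The left side carries the nontrivial factor of θ_{m+n+1} - θ_m; the two terms on the right
      -- come from `Φ (m + 1) n` and `Φ m n`.
      · have : ca * (cb - bb * (q ^ 2 * a ^ 2 * b)) / (bb * q ^ 2 * a ^ 2 * b) =
            cb * (ca + r₀ * bc * bb * q * a * p) / (bb * (q ^ 2 * a ^ 2) * b) - yn := by
          rw [e2]
          field_simp
          ring
        rw [this]
        field_simp) d 0 (by omega)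
  have hsum : ∑ k ∈ Finset.Icc 0 (0 + d), f k *
      Lagrange.nodalWeight (Finset.Icc 0 (0 + d)) (theta q bb cb) k =
      ∑ M ∈ Finset.range (d + 1), n M := by
    have : Finset.Icc 0 (0 + d) = Finset.range (d + 1) := by ext; simp
    rw [this]
    refine Finset.sum_congr rfl fun M hM => ?_
    rw [Finset.mem_range] at hM
    rw [← this, nodalWeight_theta d q bb cb (by omega)]
    have := hW M (by omega)
    simp only [f]
    field_simp
  rw [← hsum, hrec]
  simp only [Φ, K, f, y, zero_mul, pow_zero, inv_one, mul_one, zero_add]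
  rw [mul_div_assoc, ← Finset.prod_div_distrib]
  congr 1
  refine Finset.prod_congr rfl fun j _ => ?_
  rw [div_div]

end


/-! ### Product formula -/

/-- With G(k) = c - b q^{2k}, the numerators give G(d+1), …, G(2d-1) and the second product gives
G(1), …, G(d). The denominators are the even and the odd members of the same list G(1), …, G(2d-1).
-/
theorem prod_subFactor {d : ℕ} {q b c : ℂ}
    (hG : ∀ k, 1 ≤ k → k < 2 * d → c - b * (q ^ 2) ^ k ≠ 0) :
    (∏ j ∈ Finset.range d, (subFactor d q b c j / (c - b * (q ^ 2) ^ (2 * j + 1)))) *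
      ∏ j ∈ Finset.range d, (c - b * (q ^ 2) ^ (j + 1)) = 1 := by
  rcases d with _ | e
  · simp
  let G : ℕ → ℂ := fun k => c - b * (q ^ 2) ^ k
  have hsub : ∀ j ∈ Finset.range e, subFactor (e + 1) q b c j = G (e + 1 + (j + 1)) / G (2 * j + 2) := by
    intro j hj
    rw [Finset.mem_range] at hj
    rw [subFactor, if_neg (by omega), show j + 1 + (e + 1) = e + 1 + (j + 1) by ring]
  have hlast : subFactor (e + 1) q b c e = 1 := by simp [subFactor]
  have hsplit : ∀ n, ∏ j ∈ Finset.range (2 * n), G (j + 1) =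
      ∏ j ∈ Finset.range n, (G (2 * j + 1) * G (2 * j + 2)) := by
    intro n
    induction n with
    | zero => simp
    | succ n ih =>
      rw [Finset.prod_range_succ, ← ih, mul_add, Finset.prod_range_succ, Finset.prod_range_succ]
      ring
  have h1 : (∏ j ∈ Finset.range (e + 1), G (j + 1)) * ∏ j ∈ Finset.range e, G (e + 1 + (j + 1)) =
      (∏ j ∈ Finset.range e, (G (2 * j + 1) * G (2 * j + 2))) * G (2 * e + 1) := by
    rw [← hsplit, ← Finset.prod_range_succ (fun j => G (j + 1)),
      show 2 * e + 1 = (e + 1) + e by ring, Finset.prod_range_add _ (e + 1)]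
    rfl
  rw [Finset.prod_div_distrib, Finset.prod_range_succ, Finset.prod_congr rfl hsub, hlast, mul_one,
    Finset.prod_div_distrib, Finset.prod_range_succ (fun j => c - b * (q ^ 2) ^ (2 * j + 1))]
  rw [Finset.prod_mul_distrib] at h1
  have hn : ∀ k, 1 ≤ k → k < 2 * (e + 1) → G k ≠ 0 := hG
  have h2 : ∏ j ∈ Finset.range e, G (2 * j + 2) ≠ 0 :=
    Finset.prod_ne_zero_iff.mpr fun j hj => hn _ (by omega) (by rw [Finset.mem_range] at hj; omega)
  have h3 : ∏ j ∈ Finset.range e, G (2 * j + 1) ≠ 0 :=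
    Finset.prod_ne_zero_iff.mpr fun j hj => hn _ (by omega) (by rw [Finset.mem_range] at hj; omega)
  have h4 : G (2 * e + 1) ≠ 0 := hn _ (by omega) (by omega)
  change (∏ j ∈ Finset.range e, G (e + 1 + (j + 1))) / (∏ j ∈ Finset.range e, G (2 * j + 2)) /
    ((∏ j ∈ Finset.range e, G (2 * j + 1)) * G (2 * e + 1)) *
      (∏ j ∈ Finset.range (e + 1), G (j + 1)) = 1
  field_simp
  linear_combination h1

/-- Source of the sign and power of q in the final formula: the exponents 4 + 6j sum to d(3d+1), and
the constant denominator subtracts 4d². -/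
theorem prod_pow_range {q : ℂ} (hq : q ≠ 0) (d : ℕ) :
    ∏ j ∈ Finset.range d, (-((q ^ 2) ^ 2 * ((q ^ 2) ^ j) ^ 3 / ((q ^ 2) ^ d) ^ 2)) =
      ((-1) ^ d * q ^ ((d : ℤ) * ((d : ℤ) - 1)))⁻¹ := by
  have h : ∀ n : ℕ, ∏ j ∈ Finset.range n, (-((q ^ 2) ^ 2 * ((q ^ 2) ^ j) ^ 3)) =
      (-1) ^ n * q ^ ((n : ℤ) * (3 * n + 1)) := by
    intro n
    induction n with
    | zero => simp
    | succ n ih =>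
      rw [Finset.prod_range_succ, ih]
      have : ((n + 1 : ℕ) : ℤ) * (3 * ((n + 1 : ℕ) : ℤ) + 1) =
          (n : ℤ) * (3 * n + 1) + ((6 * n + 4 : ℕ) : ℤ) := by push_cast; ring
      rw [this, zpow_add₀ hq, zpow_natCast]
      ring
  have h2 : ∀ j, -((q ^ 2) ^ 2 * ((q ^ 2) ^ j) ^ 3 / ((q ^ 2) ^ d) ^ 2) =
      -((q ^ 2) ^ 2 * ((q ^ 2) ^ j) ^ 3) / ((q ^ 2) ^ d) ^ 2 := fun j => by ring
  simp only [h2]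
  rw [Finset.prod_div_distrib, h, Finset.prod_const, Finset.card_range, mul_inv,
    ← inv_pow, inv_neg, inv_one, mul_div_assoc]
  congr 1
  rw [div_eq_iff (by positivity), ← zpow_neg,
    show (((q ^ 2) ^ d) ^ 2) ^ d = q ^ ((4 * d * d : ℕ) : ℤ) by rw [zpow_natCast]; ring,
    ← zpow_add₀ hq]
  congr 1
  push_cast
  ring

section

variable {d : ℕ} {q r₀ ba ca bb cb bc cc : ℂ}

theorem theta_zero_sub_succ (hq : q ≠ 0) (b c : ℂ) (j : ℕ) :
    theta q b c 0 - theta q b c (j + 1) =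
      (1 - ((q ^ 2) ^ (j + 1))⁻¹) * (c - b * (q ^ 2) ^ (j + 1)) := by
  rw [theta_sub_theta hq, pow_zero, inv_one, zero_add]

theorem sub_eq_qPoch_factor {b c : ℂ} (hr : r₀ ≠ 0) (h : b * c = (r₀ ^ 2)⁻¹) (j : ℕ) :
    c - b * (q ^ 2) ^ (j + 1) = c * (1 - q ^ 2 * r₀ ^ 2 * b ^ 2 * (q ^ 2) ^ j) := by
  have : b * (b * c) * r₀ ^ 2 = b := by rw [h]; field_simp
  rw [pow_succ]
  linear_combination (q ^ 2) ^ j * q ^ 2 * this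

/-- Each factor splits into a power of q, factors of the Pochhammer symbols, and a square whose
product over `j` is 1 by `prod_subFactor`. The square arises because `lowEntry` and `thirdLow` both
contain `subFactor`. -/
theorem prod_closed_form (hq : q ≠ 0) (hqd : ∀ k, 0 < k → (q ^ 2) ^ k ≠ 1) (hr : r₀ ≠ 0)
    (ha : ba * ca = (r₀ ^ 2)⁻¹) (hb : bb * cb = (r₀ ^ 2)⁻¹) (hc : bc * cc = (r₀ ^ 2)⁻¹)
    (hG : ∀ k, 1 ≤ k → k < 2 * d → cb - bb * (q ^ 2) ^ k ≠ 0)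
    (hGa : ∀ k < d, ca - ba * (q ^ 2) ^ (k + 1) ≠ 0)
    (hGc : ∀ k < d, cc - bc * (q ^ 2) ^ (k + 1) ≠ 0)
    (hU : ∀ k < d, ratioNum q r₀ ca cb bc k ≠ 0)
    (hZ : ∀ k < d, ratioDen q r₀ ca bb bc k ≠ 0)
    (hy : ∀ k < d, lowFactor d q r₀ ca cb bc k ≠ 0) :
    ∏ j ∈ Finset.range d,
        (lowEntry d q r₀ ba ca bb cb bc cc (j + 1) * thirdLow d q r₀ ba ca bb cb bc cc (j + 1)
          / gStep q r₀ ca bb cb bc j * (theta q bb cb 0 - theta q bb cb (j + 1))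
          * (ca / (bb * (1 - (q ^ 2) ^ (j + 1)) * lowFactor d q r₀ ca cb bc j))
          / ((theta q ba ca 0 - theta q ba ca (j + 1))
            * (theta q bc cc 0 - theta q bc cc (j + 1)))) =
      ((-1) ^ d * q ^ ((d : ℤ) * ((d : ℤ) - 1)))⁻¹ *
        ((qPoch (-(q * r₀ * bb * bc / ba)) (q ^ 2) d * qPoch (-(q * r₀ * ba * bb / bc)) (q ^ 2) d
            * qPoch (-(q * r₀ * ba * bc / bb)) (q ^ 2) d) /
          (qPoch (q ^ 2 * r₀ ^ 2 * ba ^ 2) (q ^ 2) d * qPoch (q ^ 2 * r₀ ^ 2 * bb ^ 2) (q ^ 2) d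
            * qPoch (q ^ 2 * r₀ ^ 2 * bc ^ 2) (q ^ 2) d)) := by
  have hr2 : (r₀ ^ 2)⁻¹ ≠ 0 := by positivity
  have hca : ca ≠ 0 := right_ne_zero_of_mul (ha ▸ hr2)
  have hba : ba ≠ 0 := left_ne_zero_of_mul (ha ▸ hr2)
  have hbc : bc ≠ 0 := left_ne_zero_of_mul (hc ▸ hr2)
  have hcc : cc ≠ 0 := right_ne_zero_of_mul (hc ▸ hr2)
  have hcb : cb ≠ 0 := right_ne_zero_of_mul (hb ▸ hr2)
  have hbb : bb ≠ 0 := left_ne_zero_of_mul (hb ▸ hr2)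
  -- `lowFactor` runs through the factors of this Pochhammer symbol backwards, with j replaced by
  -- d-1-j.
  have hreflect : qPoch (-(q * r₀ * ba * bc / bb)) (q ^ 2) d =
      ∏ j ∈ Finset.range d, (lowFactor d q r₀ ca cb bc j / ca) := by
    rw [qPoch, ← Finset.prod_range_reflect]
    refine Finset.prod_congr rfl fun j hj => ?_
    rw [Finset.mem_range] at hj
    have h1 : (q ^ 2) ^ d = (q ^ 2) ^ (d - 1 - j) * (q ^ 2) ^ j * q ^ 2 := by
      rw [← pow_add, ← pow_succ]; congr 1; omega
    have h2 : (q ^ 2) ^ j ≠ 0 := by positivity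
    have h3 : cb / ca = ba / bb := by
      rw [div_eq_div_iff hca hbb]; linear_combination hb - ha
    rw [lowFactor, h1]
    trans 1 + q * r₀ * bc * (ba / bb) * (q ^ 2) ^ (d - 1 - j)
    · ring
    · rw [← h3]; field_simp
  have hfU : ∀ j, 1 - -(q * r₀ * bb * bc / ba) * (q ^ 2) ^ j = ratioNum q r₀ ca cb bc j / cb := by
    intro j
    have h3 : bb / ba = ca / cb := by rw [div_eq_div_iff hba hcb]; linear_combination hb - ha
    rw [ratioNum]
    trans 1 + q * r₀ * bc * (bb / ba) * (q ^ 2) ^ j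
    · ring
    · rw [h3]; field_simp
  have hfZ : ∀ j, 1 - -(q * r₀ * ba * bb / bc) * (q ^ 2) ^ j =
      ratioDen q r₀ ca bb bc j / (r₀ * ca * bc) := by
    intro j
    have h3 : r₀ * ba = (r₀ * ca)⁻¹ := by
      refine eq_inv_of_mul_eq_one_left ?_
      have := mul_inv_cancel₀ (pow_ne_zero 2 hr)
      linear_combination r₀ ^ 2 * ha + this
    rw [ratioDen]
    trans 1 + q * (r₀ * ba) * bb / bc * (q ^ 2) ^ j
    · ring
    · rw [h3]; field_simp
  have hfG : ∀ b c : ℂ, b * c = (r₀ ^ 2)⁻¹ → ∀ j, 1 - q ^ 2 * r₀ ^ 2 * b ^ 2 * (q ^ 2) ^ j =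
      (c - b * (q ^ 2) ^ (j + 1)) / c := by
    intro b c h j
    have hc0 : c ≠ 0 := right_ne_zero_of_mul (h ▸ hr2)
    rw [sub_eq_qPoch_factor hr h]
    field_simp
  have hcc' : cc = bb * cb / bc := by
    rw [eq_div_iff hbc]; linear_combination hc - hb
  have hterm : ∀ j ∈ Finset.range d,
      lowEntry d q r₀ ba ca bb cb bc cc (j + 1) * thirdLow d q r₀ ba ca bb cb bc cc (j + 1)
          / gStep q r₀ ca bb cb bc j * (theta q bb cb 0 - theta q bb cb (j + 1))
          * (ca / (bb * (1 - (q ^ 2) ^ (j + 1)) * lowFactor d q r₀ ca cb bc j))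
          / ((theta q ba ca 0 - theta q ba ca (j + 1))
            * (theta q bc cc 0 - theta q bc cc (j + 1))) =
      -((q ^ 2) ^ 2 * ((q ^ 2) ^ j) ^ 3 / ((q ^ 2) ^ d) ^ 2) *
        (((1 - -(q * r₀ * bb * bc / ba) * (q ^ 2) ^ j) *
            (1 - -(q * r₀ * ba * bb / bc) * (q ^ 2) ^ j) *
            (lowFactor d q r₀ ca cb bc j / ca)) /
          ((1 - q ^ 2 * r₀ ^ 2 * ba ^ 2 * (q ^ 2) ^ j) *
            (1 - q ^ 2 * r₀ ^ 2 * bb ^ 2 * (q ^ 2) ^ j) *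
            (1 - q ^ 2 * r₀ ^ 2 * bc ^ 2 * (q ^ 2) ^ j))) *
        (subFactor d q bb cb j / (cb - bb * (q ^ 2) ^ (2 * j + 1)) *
          (cb - bb * (q ^ 2) ^ (j + 1))) ^ 2 := by
    intro j hj
    rw [Finset.mem_range] at hj
    rw [hfU, hfZ, hfG ba ca ha, hfG bb cb hb, hfG bc cc hc, theta_zero_sub_succ hq,
      theta_zero_sub_succ hq, theta_zero_sub_succ hq, thirdLow, lowEntry_succ hq hr ha hb hc, gStep]
    have hGa' := hGa j hj
    have hGc' := hGc j hj
    have hGb' := hG (j + 1) (by omega) (by omega)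
    have hD := hG (2 * j + 1) (by omega) (by omega)
    have hU' := hU j hj
    have hZ' := hZ j hj
    have hy' := hy j hj
    have hw : 1 - (q ^ 2) ^ (j + 1) ≠ 0 := sub_ne_zero.mpr (hqd _ (by omega)).symm
    have hm : (q ^ 2) ^ j ≠ 0 := by positivity
    have hp : (q ^ 2) ^ d ≠ 0 := by positivity
    have hw' : 1 - ((q ^ 2) ^ (j + 1))⁻¹ = -(1 - (q ^ 2) ^ (j + 1)) / (q ^ 2 * (q ^ 2) ^ j) := by
      rw [pow_succ]
      field_simp
      ring
    rw [hw']
    generalize ca - ba * (q ^ 2) ^ (j + 1) = Ga at *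
    generalize cb - bb * (q ^ 2) ^ (j + 1) = Gb at *
    generalize cc - bc * (q ^ 2) ^ (j + 1) = Gc at *
    generalize cb - bb * (q ^ 2) ^ (2 * j + 1) = D at *
    generalize 1 - (q ^ 2) ^ (j + 1) = w at *
    rw [pow_succ (q ^ 2) j, hcc']
    generalize ratioNum q r₀ ca cb bc j = U at *
    generalize ratioDen q r₀ ca bb bc j = Z at *
    generalize lowFactor d q r₀ ca cb bc j = y at *
    generalize subFactor d q bb cb j = α at *
    generalize (q ^ 2) ^ j = m at *
    generalize (q ^ 2) ^ d = p at *
    field_simp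
  rw [Finset.prod_congr rfl hterm, Finset.prod_mul_distrib, Finset.prod_pow,
    Finset.prod_mul_distrib (f := fun j => subFactor d q bb cb j / _), prod_subFactor hG, one_pow,
    mul_one, Finset.prod_mul_distrib, prod_pow_range hq, hreflect]
  congr 1
  simp only [qPoch, ← Finset.prod_mul_distrib, ← Finset.prod_div_distrib]

end


/-! ### Consequences of the Leonard triple axioms -/

namespace IsLeonardTriple

variable {d : ℕ} {q r₀ : ℂ} {b c : Fin 3 → ℂ} {A : Fin 3 → Module.End ℂ V}

/-- `A j` is irreducible tridiagonal in an eigenbasis of `A (j + 1)`, so its eigenspaces are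
one-dimensional. -/
theorem exists_smul_eq (hA : IsLeonardTriple d q r₀ b c A) (j : Fin 3) {γ : ℂ} {v w : V}
    (hv : A j v = γ • v) (hw : A j w = γ • w) (hv0 : v ≠ 0) : ∃ t : ℂ, w = t • v := by
  obtain ⟨u, -, hu⟩ := hA.leonard (j + 1)
  exact exists_smul_eq_of_irreducibleTridiagonal u (hu j (by fin_cases j <;> decide)) hv hw hv0

theorem theta_injective (hA : IsLeonardTriple d q r₀ b c A) (j : Fin 3) (M N : ℕ) (hM : M ≤ d)
    (hN : N ≤ d) (h : theta q (b j) (c j) M = theta q (b j) (c j) N) : M = N := by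
  obtain ⟨u, hu, -⟩ := hA.leonard j
  have h1 := hu ⟨M, by omega⟩
  have h2 := hu ⟨N, by omega⟩
  simp only at h1 h2
  rw [← h] at h2
  obtain ⟨t, ht⟩ := hA.exists_smul_eq j h1 h2 (u.ne_zero _)
  by_contra hne
  have h3 := congrArg (fun v => u.repr v ⟨N, by omega⟩) ht
  simp [hne] at h3

/-- For k ≤ d this is a factor of θ_0 - θ_k, and for k > d a factor of θ_{k-d} - θ_d. The excluded
values k = 0 and k = 2d are those where the matrix entries need the convention that the cancelled
quotient is 1. -/
theorem sub_ne_zero (hq : q ≠ 0) (hA : IsLeonardTriple d q r₀ b c A) (j : Fin 3) (k : ℕ) (hk1 : 1 ≤ k)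
    (hk : k < 2 * d) : c j - b j * (q ^ 2) ^ k ≠ 0 := by
  intro h0
  rcases Nat.lt_or_ge d k with h | h
  · have h1 := theta_sub_theta hq (b j) (c j) (k - d) d
    rw [show k - d + d = k by omega, h0, mul_zero, _root_.sub_eq_zero] at h1
    have := hA.theta_injective j _ _ (by omega) le_rfl h1
    omega
  · have h1 := theta_sub_theta hq (b j) (c j) 0 k
    rw [show 0 + k = k by omega, h0, mul_zero, _root_.sub_eq_zero] at h1
    have := hA.theta_injective j _ _ (by omega) h h1
    omega

/-- The entries of one of the maps in an eigenbasis of another one do not vanish next to the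
diagonal. -/
theorem entry_ne_zero (hA : IsLeonardTriple d q r₀ b c A) {j k : Fin 3} (hjk : k ≠ j)
    (v : Module.Basis (Fin (d + 1)) ℂ V) (hv : ∀ M, A j (v M) = theta q (b j) (c j) M • v M)
    (t : Matrix (Fin (d + 1)) (Fin (d + 1)) ℂ) (ht : ∀ M, A k (v M) = ∑ N, t N M • v N)
    (M N : Fin (d + 1)) (hMN : M.val = N.val + 1 ∨ N.val = M.val + 1) : t M N ≠ 0 := by
  obtain ⟨u, hu, hirr⟩ := hA.leonard j
  have hs : ∀ M, ∃ s : ℂ, v M = s • u M := fun M =>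
    hA.exists_smul_eq j (hu M) (hv M) (u.ne_zero M)
  choose s hs using hs
  have hs0 : ∀ M, s M ≠ 0 := by
    intro M h
    apply v.ne_zero M
    rw [hs, h, zero_smul]
  have h1 := congrArg (fun x => u.repr x M) (ht N)
  simp only [hs, map_smul, map_sum, Finsupp.finsetSum_apply, Finsupp.smul_apply,
    Module.Basis.repr_self, smul_eq_mul] at h1
  rw [Finset.sum_eq_single M (by intro K _ hK; simp [hK]) (by simp),
    Finsupp.single_eq_same, mul_one] at h1
  have h2 := ((hirr k hjk) M N).1 hMN
  rw [LinearMap.toMatrix_apply] at h2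
  intro h0
  rw [h0, zero_mul] at h1
  exact (mul_ne_zero (hs0 N) h2) h1

/-- The expression of the third map in terms of the other two, for all cyclic orders. -/
theorem third_cyclic (hq : q ≠ 0) (hq4 : q ^ 4 ≠ 1) (hr : r₀ ≠ 0)
    (hA : IsLeonardTriple d q r₀ b c A) (i : Fin 3) :
    A (i + 2) = (r₀ / (q ^ 2 - (q ^ 2)⁻¹)) • qComm q (A (i + 1)) (A i)
      + (r₀ * omega d q r₀ b c i (i + 1) (i + 2) / ((q - q⁻¹) * (q ^ 2 - (q ^ 2)⁻¹))) •
        (1 : Module.End ℂ V) := by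
  have e4 : q ^ 4 - 1 ≠ 0 := _root_.sub_ne_zero.mpr hq4
  have e2 : q ^ 2 - 1 ≠ 0 := by
    intro h; apply e4; linear_combination (q ^ 2 + 1) * h
  have e2' : q ^ 2 + 1 ≠ 0 := by
    intro h; apply e4; linear_combination (q ^ 2 - 1) * h
  have hs : q ^ 2 - (q ^ 2)⁻¹ = (q ^ 4 - 1) / q ^ 2 := by field_simp
  have hs1 : q - q⁻¹ = (q ^ 2 - 1) / q := by field_simp
  have hs2 : q + q⁻¹ = (q ^ 2 + 1) / q := by field_simp
  have hs3 : q ^ 4 - 1 = (q ^ 2 - 1) * (q ^ 2 + 1) := by ring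
  have hω : ∀ i j k, omega d q r₀ b c i j k = omega d q r₀ b c j i k := by
    intro i j k; simp only [omega]; ring
  have h3 := hA.third
  -- Both double commutators are rewritten with [A 1, A 0]_q inside, so that `third` can replace it
  -- by `A 2`. The Askey-Wilson relations can then be solved for `A 0` and `A 1`.
  have key1 : qComm q⁻¹ (A 1) (qComm q (A 1) (A 0)) = -qComm q (qComm q (A 1) (A 0)) (A 1) := by
    simp only [qComm, inv_inv]; module
  have key2 : qComm q⁻¹ (A 0) (qComm q (A 0) (A 1)) = -qComm q (A 0) (qComm q (A 1) (A 0)) := by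
    simp only [qComm, inv_inv, mul_sub, sub_mul, smul_mul_assoc, mul_smul_comm, mul_assoc]
    match_scalars <;> (field_simp; try ring)
  have hlin : ∀ (x y : ℂ) (Y Z : Module.End ℂ V), qComm q (x • Z + y • 1) Y =
      x • qComm q Z Y + (y * (q - q⁻¹)) • Y := by
    intro x y Y Z
    simp only [qComm, mul_add, add_mul, smul_mul_assoc, mul_smul_comm, one_mul, mul_one]
    module
  have hlin2 : ∀ (x y : ℂ) (Y Z : Module.End ℂ V), qComm q Y (x • Z + y • 1) =
      x • qComm q Y Z + (y * (q - q⁻¹)) • Y := by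
    intro x y Y Z
    simp only [qComm, mul_add, add_mul, smul_mul_assoc, mul_smul_comm, one_mul, mul_one]
    module
  fin_cases i
  · exact h3
  · have h1 := hA.aw_second
    rw [key1, neg_eq_iff_eq_neg] at h1
    change A 0 = (r₀ / (q ^ 2 - (q ^ 2)⁻¹)) • qComm q (A 2) (A 1) +
      (r₀ * omega d q r₀ b c 1 2 0 / ((q - q⁻¹) * (q ^ 2 - (q ^ 2)⁻¹))) • (1 : Module.End ℂ V)
    rw [h3, hlin, h1, hs, hs1, hs2, hs3]
    match_scalars <;> field_simp <;> ring
  · have h1 := hA.aw_first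
    rw [key2, neg_eq_iff_eq_neg] at h1
    change A 1 = (r₀ / (q ^ 2 - (q ^ 2)⁻¹)) • qComm q (A 0) (A 2) +
      (r₀ * omega d q r₀ b c 2 0 1 / ((q - q⁻¹) * (q ^ 2 - (q ^ 2)⁻¹))) • (1 : Module.End ℂ V)
    rw [h3, hlin2, h1, hω 2 0 1, hs, hs1, hs2, hs3]
    match_scalars <;> field_simp <;> ring

theorem third_eq (hq : q ≠ 0) (hq4 : q ^ 4 ≠ 1) (hr : r₀ ≠ 0)
    (hA : IsLeonardTriple d q r₀ b c A) (i : Fin 3) :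
    A (i + 2) = (r₀ / (q ^ 2 - (q ^ 2)⁻¹)) • qComm q (A (i + 1)) (A i)
      + thirdConst d q r₀ (b i) (c i) (b (i + 1)) (c (i + 1)) (b (i + 2)) (c (i + 2)) •
        (1 : Module.End ℂ V) := by
  rw [hA.third_cyclic hq hq4 hr i]
  congr 2
  have e4 : q ^ 4 - 1 ≠ 0 := _root_.sub_ne_zero.mpr hq4
  have e2 : q ^ 2 - 1 ≠ 0 := by
    intro h; apply e4; linear_combination (q ^ 2 + 1) * h
  have e2' : q ^ 2 + 1 ≠ 0 := by
    intro h; apply e4; linear_combination (q ^ 2 - 1) * h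
  have hs : q ^ 2 - (q ^ 2)⁻¹ = (q ^ 2 - 1) * (q ^ 2 + 1) / q ^ 2 := by field_simp; ring
  have hs1 : q - q⁻¹ = (q ^ 2 - 1) / q := by field_simp
  have hs2 : q + q⁻¹ = (q ^ 2 + 1) / q := by field_simp
  have h1 : q ^ ((d : ℤ) + 1) = q ^ d * q := by rw [zpow_add₀ hq]; norm_cast; simp
  have h2 : q ^ (-(d : ℤ) - 1) = (q ^ d * q)⁻¹ := by
    rw [← h1, ← zpow_neg]; congr 1; ring
  rw [omega, thirdConst, h1, h2, hs, hs1, hs2]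
  generalize thetaMid d q (b i) (c i) = x
  generalize thetaMid d q (b (i + 1)) (c (i + 1)) = y
  generalize thetaMid d q (b (i + 2)) (c (i + 2)) = z
  generalize q ^ d * q + (q ^ d * q)⁻¹ = w
  field_simp

end IsLeonardTriple

/-! ### The third map in the eigenbasis of the second one -/

theorem map_sum_smul_basis {n : ℕ} (u : Module.Basis (Fin n) ℂ V) (T : Module.End ℂ V)
    (t : Matrix (Fin n) (Fin n) ℂ) (ht : ∀ M, T (u M) = ∑ N, t N M • u N) (x : Fin n → ℂ) :
    T (∑ M, x M • u M) = ∑ N, (∑ M, t N M * x M) • u N := by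
  simp only [map_sum, map_smul, ht, Finset.smul_sum, Finset.sum_smul, smul_smul]
  rw [Finset.sum_comm]
  simp only [mul_comm]

section

variable {d : ℕ} {q r₀ ba ca bb cb bc cc : ℂ} {Xa Xb Xc : Module.End ℂ V}
  {vb : Module.Basis (Fin (d + 1)) ℂ V}

/-- As the second map is diagonal, its q-commutator with the first multiplies entry (N, M) by q θ_N
- q⁻¹ θ_M. For neighbouring indices one of the two exponentials in this factor cancels, which
explains the form of `thirdLow` and `thirdHigh`. -/
theorem third_apply_basis (hq : q ≠ 0) (hq4 : q ^ 4 ≠ 1)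
    (hXb : ∀ M, Xb (vb M) = theta q bb cb M • vb M)
    (hXa : ∀ M, Xa (vb M) = ∑ N, tri d (lowEntry d q r₀ ba ca bb cb bc cc)
      (diagEntry d q r₀ ba ca bb cb bc cc) (highEntry d q r₀ ba ca bb cb bc cc) N M • vb N)
    (hXc : Xc = (r₀ / (q ^ 2 - (q ^ 2)⁻¹)) • qComm q Xb Xa
      + thirdConst d q r₀ ba ca bb cb bc cc • (1 : Module.End ℂ V)) (M : Fin (d + 1)) :
    Xc (vb M) = ∑ N, tri d (thirdLow d q r₀ ba ca bb cb bc cc)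
      (thirdDiag d q r₀ ba ca bb cb bc cc) (thirdHigh d q r₀ ba ca bb cb bc cc) N M • vb N := by
  have e4 : q ^ 4 - 1 ≠ 0 := sub_ne_zero.mpr hq4
  have e2 : q ^ 2 - 1 ≠ 0 := by
    intro h; apply e4; linear_combination (q ^ 2 + 1) * h
  have e2' : q ^ 2 + 1 ≠ 0 := by
    intro h; apply e4; linear_combination (q ^ 2 - 1) * h
  have hs : q ^ 2 - (q ^ 2)⁻¹ = (q ^ 2 - 1) * (q ^ 2 + 1) / q ^ 2 := by field_simp; ring
  have hs2 : q + q⁻¹ = (q ^ 2 + 1) / q := by field_simp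
  have h1 : vb M = ∑ N, (if N = M then (1 : ℂ) else 0) • vb N := by simp
  rw [hXc, LinearMap.add_apply, LinearMap.smul_apply, LinearMap.smul_apply, Module.End.one_apply,
    qComm, LinearMap.sub_apply, LinearMap.smul_apply, LinearMap.smul_apply, Module.End.mul_apply,
    Module.End.mul_apply, hXb, map_smul, hXa, map_sum]
  simp only [map_smul, hXb]
  conv_lhs => rw [h1]
  simp only [Finset.smul_sum, smul_smul, ← Finset.sum_sub_distrib, ← Finset.sum_add_distrib,
    ← sub_smul, ← add_smul]
  refine Finset.sum_congr rfl fun N _ => ?_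
  congr 1
  simp only [tri, Matrix.of_apply]
  by_cases c1 : N.val = M.val + 1
  · have c2 : N ≠ M := by rintro rfl; omega
    rw [if_pos c1, if_pos c1, if_neg c2, thirdLow, theta_eq, theta_eq, c1, hs]
    have : (q ^ 2) ^ M.val ≠ 0 := by positivity
    rw [pow_succ]
    field_simp
    ring
  · rw [if_neg c1, if_neg c1]
    by_cases c3 : M.val = N.val + 1
    · have c2 : N ≠ M := by rintro rfl; omega
      rw [if_pos c3, if_pos c3, if_neg c2, thirdHigh, theta_eq, theta_eq, c3, hs]
      have : (q ^ 2) ^ N.val ≠ 0 := by positivity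
      rw [pow_succ]
      field_simp
      ring
    · rw [if_neg c3, if_neg c3]
      by_cases c2 : N = M
      · subst c2
        rw [if_pos rfl, if_pos rfl, if_pos rfl, thirdDiag, hs, hs2]
        field_simp
      · rw [if_neg c2, if_neg c2, if_neg c2]; ring

end


/-! ### The product of the two leading transition coefficients. -/

section

variable {d : ℕ} {q r₀ ba ca bb cb bc cc : ℂ} {Xa Xb Xc : Module.End ℂ V}
  {va vb vc : Module.Basis (Fin (d + 1)) ℂ V}

/-- The vector with coefficients `g_M` is an eigenvector of the third map. -/
theorem third_ratio_vector (hq : q ≠ 0) (hq4 : q ^ 4 ≠ 1) (hr : r₀ ≠ 0)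
    (ha : ba * ca = (r₀ ^ 2)⁻¹) (hb : bb * cb = (r₀ ^ 2)⁻¹) (hc : bc * cc = (r₀ ^ 2)⁻¹)
    (hG : ∀ k, 1 ≤ k → k < 2 * d → cb - bb * (q ^ 2) ^ k ≠ 0)
    (hU : ∀ k < d, ratioNum q r₀ ca cb bc k ≠ 0)
    (hZ : ∀ k < d, ratioDen q r₀ ca bb bc k ≠ 0) (g : ℕ → ℂ)
    (hg : ∀ k < d, g (k + 1) = g k * gStep q r₀ ca bb cb bc k) (M : Fin (d + 1)) :
    ∑ N : Fin (d + 1), tri d (thirdLow d q r₀ ba ca bb cb bc cc)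
      (thirdDiag d q r₀ ba ca bb cb bc cc) (thirdHigh d q r₀ ba ca bb cb bc cc) M N * g N =
    theta q bc cc 0 * g M := by
  have hq2 : q ^ 2 + 1 ≠ 0 := by
    intro h; apply hq4; linear_combination (q ^ 2 - 1) * h
  rw [sum_tri_mul]
  exact third_mul_ratio hq hq2 hr ha hb hc hG hU hZ g hg M (by omega)

/-- The diagonal is defined to make this true. The entries of index 0 and d + 1 vanish, so the first
and last rows are no exception. Thus the all-ones vector is an eigenvector for θ_0. -/
theorem row_sum (M : Fin (d + 1)) :
    ∑ N : Fin (d + 1), tri d (lowEntry d q r₀ ba ca bb cb bc cc)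
      (diagEntry d q r₀ ba ca bb cb bc cc) (highEntry d q r₀ ba ca bb cb bc cc) M N * 1 =
    theta q ba ca 0 := by
  rw [sum_tri_mul d _ _ _ (fun _ => 1)]
  have h0 : lowEntry d q r₀ ba ca bb cb bc cc 0 = 0 := subEntry_zero ..
  have h1 : highEntry d q r₀ ba ca bb cb bc cc (d + 1) = 0 := superEntry_last ..
  have e0 : (if M.val = 0 then 0 else lowEntry d q r₀ ba ca bb cb bc cc M * 1) =
      lowEntry d q r₀ ba ca bb cb bc cc M := by
    split_ifs with h
    · rw [h, h0]
    · rw [mul_one]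
  have e1 : (if M.val = d then 0 else highEntry d q r₀ ba ca bb cb bc cc (M + 1) * 1) =
      highEntry d q r₀ ba ca bb cb bc cc (M + 1) := by
    split_ifs with h
    · rw [h, h1]
    · rw [mul_one]
  rw [e0, e1, diagEntry]
  ring

theorem repr_eq_tri {v : Module.Basis (Fin (d + 1)) ℂ V} {T : Module.End ℂ V} {lo di up : ℕ → ℂ}
    (h : ∀ M, T (v M) = ∑ N, tri d lo di up N M • v N) (M N : Fin (d + 1)) :
    v.repr (T (v M)) N = tri d lo di up N M := by
  rw [h]
  exact congrFun (v.repr_sum_self fun N => tri d lo di up N M) N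

/-- The product of the two leading transition coefficients. -/
theorem leading_coefficient_product (hq : q ≠ 0) (hqd : ∀ k, 0 < k → (q ^ 2) ^ k ≠ 1)
    (hq4 : q ^ 4 ≠ 1) (hr : r₀ ≠ 0)
    (ha : ba * ca = (r₀ ^ 2)⁻¹) (hb : bb * cb = (r₀ ^ 2)⁻¹) (hc : bc * cc = (r₀ ^ 2)⁻¹)
    (hθa : ∀ M N, M ≤ d → N ≤ d → theta q ba ca M = theta q ba ca N → M = N)
    (hθb : ∀ M N, M ≤ d → N ≤ d → theta q bb cb M = theta q bb cb N → M = N)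
    (hθc : ∀ M N, M ≤ d → N ≤ d → theta q bc cc M = theta q bc cc N → M = N)
    (hG : ∀ k, 1 ≤ k → k < 2 * d → cb - bb * (q ^ 2) ^ k ≠ 0)
    (hlow : ∀ k < d, lowEntry d q r₀ ba ca bb cb bc cc (k + 1) ≠ 0)
    (hhigh : ∀ k < d, highEntry d q r₀ ba ca bb cb bc cc (k + 1) ≠ 0)
    (hXb : ∀ M, Xb (vb M) = theta q bb cb M • vb M)
    (hXa : ∀ M, Xa (vb M) = ∑ N, tri d (lowEntry d q r₀ ba ca bb cb bc cc)
      (diagEntry d q r₀ ba ca bb cb bc cc) (highEntry d q r₀ ba ca bb cb bc cc) N M • vb N)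
    (hXc : Xc = (r₀ / (q ^ 2 - (q ^ 2)⁻¹)) • qComm q Xb Xa
      + thirdConst d q r₀ ba ca bb cb bc cc • (1 : Module.End ℂ V))
    (hva : ∀ M, Xa (va M) = theta q ba ca M • va M)
    (hvc : ∀ M, Xc (vc M) = theta q bc cc M • vc M)
    (huniq : ∀ {γ : ℂ} {v w : V}, Xa v = γ • v → Xa w = γ • w → v ≠ 0 → ∃ t : ℂ, w = t • v)
    (hrel : vb 0 = ∑ M, va M) (g : ℕ → ℂ) (hg1 : g 0 = 1)
    (hg : ∀ k < d, g (k + 1) = g k * gStep q r₀ ca bb cb bc k) (g₀ : ℂ)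
    (hexp : vc 0 = ∑ M : Fin (d + 1), (g₀ * g M) • vb M) :
    g₀ * vc.repr (va 0) 0 = ((-1) ^ d * q ^ ((d : ℤ) * ((d : ℤ) - 1)))⁻¹ *
        ((qPoch (-(q * r₀ * bb * bc / ba)) (q ^ 2) d * qPoch (-(q * r₀ * ba * bb / bc)) (q ^ 2) d
            * qPoch (-(q * r₀ * ba * bc / bb)) (q ^ 2) d) /
          (qPoch (q ^ 2 * r₀ ^ 2 * ba ^ 2) (q ^ 2) d * qPoch (q ^ 2 * r₀ ^ 2 * bb ^ 2) (q ^ 2) d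
            * qPoch (q ^ 2 * r₀ ^ 2 * bc ^ 2) (q ^ 2) d)) := by
  have hr2 : (r₀ ^ 2)⁻¹ ≠ 0 := by positivity
  have hcb : cb ≠ 0 := right_ne_zero_of_mul (hb ▸ hr2)
  have hbb : bb ≠ 0 := left_ne_zero_of_mul (hb ▸ hr2)
  have hU : ∀ k < d, ratioNum q r₀ ca cb bc k ≠ 0 := by
    intro k hk h; apply hlow k hk; rw [lowEntry_succ hq hr ha hb hc, h]; simp
  have hy : ∀ k < d, lowFactor d q r₀ ca cb bc k ≠ 0 := by
    intro k hk h; apply hlow k hk; rw [lowEntry_succ hq hr ha hb hc, h]; simp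
  have hα : ∀ k < d, subFactor d q bb cb k ≠ 0 := by
    intro k hk h; apply hlow k hk; rw [lowEntry_succ hq hr ha hb hc, h]; simp
  have hZ : ∀ k < d, ratioDen q r₀ ca bb bc k ≠ 0 := by
    intro k hk h; apply hhigh k hk; rw [highEntry_succ hq hr ha hb hc, h]; simp
  have hβ : ∀ k < d, superFactor q bb cb k ≠ 0 := by
    intro k hk h; apply hhigh k hk; rw [highEntry_succ hq hr ha hb hc, h]; simp
  have hgstep : ∀ k < d, gStep q r₀ ca bb cb bc k ≠ 0 := by
    intro k hk
    have := hU k hk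
    have := hZ k hk
    rw [gStep]; positivity
  have hgprod : ∀ k ≤ d, g k = ∏ j ∈ Finset.range k, gStep q r₀ ca bb cb bc j := by
    intro k
    induction k with
    | zero => intro _; simp [hg1]
    | succ k ih => intro hk; rw [hg k (by omega), ih (by omega), Finset.prod_range_succ]
  have hg0 : ∀ k ≤ d, g k ≠ 0 := by
    intro k hk
    rw [hgprod k hk]
    exact Finset.prod_ne_zero_iff.mpr fun j hj =>
      hgstep j (by rw [Finset.mem_range] at hj; omega)
  have hXcb := third_apply_basis hq hq4 hXb hXa hXc
  have hright := third_ratio_vector hq hq4 hr ha hb hc hG hU hZ g hg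
  -- The coordinate along `vc 0`, read on the basis `vb`, is a left eigenvector of the third map; it
  -- is extended by zero beyond `d`.
  let n : ℕ → ℂ := fun M => if h : M < d + 1 then vc.repr (vb ⟨M, h⟩) 0 else 0
  have hnF : ∀ M : Fin (d + 1), n M = vc.repr (vb M) 0 := fun M => dif_pos M.isLt
  have hleft : ∀ M : Fin (d + 1), ∑ N : Fin (d + 1), n N * tri d
      (thirdLow d q r₀ ba ca bb cb bc cc) (thirdDiag d q r₀ ba ca bb cb bc cc)
      (thirdHigh d q r₀ ba ca bb cb bc cc) N M = theta q bc cc 0 * n M := by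
    intro M
    have h1 := repr_of_diagonal hvc (vb M) 0
    rw [hXcb] at h1
    simp only [map_sum, map_smul, Finsupp.finsetSum_apply, Finsupp.smul_apply, smul_eq_mul] at h1
    simp only [hnF]
    exact (Finset.sum_congr rfl fun N _ => mul_comm _ _).trans h1
  have hcas := tri_left_right_eigenvector d _ _ _ g n _ hright hleft
  have hsum := sum_left_eigenvector hq hqd hr hb hθb hy n fun M hM =>
    weight_recursion hq hqd hr ha hb hc hG hU hZ hα hβ g n hg0 hg M hM (hcas M hM)
  have hsum' : ∑ M : Fin (d + 1), vc.repr (vb M) 0 = ∑ M ∈ Finset.range (d + 1), n M := by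
    rw [← Fin.sum_univ_eq_sum_range]
    exact Finset.sum_congr rfl fun M _ => (hnF M).symm
  obtain ⟨l, hl⟩ : ∃ l : ℂ, va 0 = l • ∑ M, vb M := by
    refine huniq (γ := theta q ba ca 0) ?_ (hva 0) ?_
    · have h1 := map_sum_smul_basis vb Xa _ hXa (fun _ => 1)
      simp only [row_sum, one_smul] at h1
      rw [h1, Finset.smul_sum]
    · intro h
      have h1 := congrArg (fun x => vb.repr x 0) h
      simp [Finsupp.finsetSum_apply, Finsupp.single_apply] at h1
  have hl' : vb.repr (va 0) (Fin.last d) = l := by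
    rw [hl]
    simp [Finsupp.single_apply]
  have hgap : ∀ (lo di up : ℕ → ℂ) (M N : Fin (d + 1)), M.val + 1 < N.val →
      tri d lo di up N M = 0 := by
    intro lo di up M N h
    rw [tri, Matrix.of_apply, if_neg (by omega), if_neg (by omega), if_neg (by rintro rfl; omega)]
  have hnext : ∀ (lo di up : ℕ → ℂ) (M N : Fin (d + 1)), N.val = M.val + 1 →
      tri d lo di up N M = lo (M + 1) := by
    intro lo di up M N h
    rw [tri, Matrix.of_apply, if_pos h, h]
  -- This determines `l`, the last coordinate of `va 0`, because `hrel` makes the other unknown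
  -- coordinate equal to 1. The companion `hPc` determines `n 0 * (g₀ * g d)`.
  have hPa := prod_hessenberg vb va Xa (theta q ba ca)
    (fun k => lowEntry d q r₀ ba ca bb cb bc cc (k + 1)) hva
    (fun M N h => by rw [repr_eq_tri hXa, hgap _ _ _ _ _ h])
    (fun M N h => by rw [repr_eq_tri hXa, hnext _ _ _ _ _ h])
  have hPc := prod_hessenberg vb vc Xc (theta q bc cc)
    (fun k => thirdLow d q r₀ ba ca bb cb bc cc (k + 1)) hvc
    (fun M N h => by rw [repr_eq_tri hXcb, hgap _ _ _ _ _ h])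
    (fun M N h => by rw [repr_eq_tri hXcb, hnext _ _ _ _ _ h])
  have hva0 : va.repr (vb 0) 0 = 1 := by
    rw [hrel]
    simp [Finsupp.finsetSum_apply, Finsupp.single_apply]
  have hvcd : vb.repr (vc 0) (Fin.last d) = g₀ * g d := by
    rw [hexp, vb.repr_sum_self fun M => g₀ * g M]
    simp
  rw [hl', hva0, mul_one] at hPa
  rw [hvcd, ← hnF 0, hgprod d le_rfl, Fin.val_zero] at hPc
  have hGne : ∀ b c : ℂ, (∀ M N, M ≤ d → N ≤ d → theta q b c M = theta q b c N → M = N) →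
      ∀ k < d, theta q b c 0 - theta q b c (k + 1) ≠ 0 := by
    intro b c hθ k hk h
    have := hθ 0 (k + 1) (by omega) (by omega) (sub_eq_zero.mp h)
    omega
  have hGne' : ∀ b c : ℂ, (∀ M N, M ≤ d → N ≤ d → theta q b c M = theta q b c N → M = N) →
      ∀ k < d, c - b * (q ^ 2) ^ (k + 1) ≠ 0 := by
    intro b c hθ k hk h
    apply hGne b c hθ k hk
    rw [theta_zero_sub_succ hq, h, mul_zero]
  have hpa0 : ∏ k ∈ Finset.range d, (theta q ba ca 0 - theta q ba ca (k + 1)) ≠ 0 :=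
    Finset.prod_ne_zero_iff.mpr fun k hk => hGne _ _ hθa k (Finset.mem_range.mp hk)
  have hpc0 : ∏ k ∈ Finset.range d, (theta q bc cc 0 - theta q bc cc (k + 1)) ≠ 0 :=
    Finset.prod_ne_zero_iff.mpr fun k hk => hGne _ _ hθc k (Finset.mem_range.mp hk)
  have hgs0 : ∏ j ∈ Finset.range d, gStep q r₀ ca bb cb bc j ≠ 0 :=
    Finset.prod_ne_zero_iff.mpr fun k hk => hgstep k (Finset.mem_range.mp hk)
  have hW : thetaWeight d q bb cb 0 =
      ∏ j ∈ Finset.range d, (theta q bb cb 0 - theta q bb cb (j + 1)) := by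
    simp only [thetaWeight, Finset.prod_range_zero, one_mul, Nat.sub_zero]
    exact Finset.prod_congr rfl fun j _ => by rw [zero_add, add_comm]
  have hH : vc.repr (va 0) 0 = l * ∑ M : Fin (d + 1), vc.repr (vb M) 0 := by
    rw [hl]
    simp
  rw [hH, hsum', hsum, hW, ← prod_closed_form hq hqd hr ha hb hc hG (hGne' _ _ hθa)
    (hGne' _ _ hθc) hU hZ hy]
  simp only [Finset.prod_div_distrib, Finset.prod_mul_distrib] at hPa hPc ⊢
  -- Replacing both products of entries leaves `l`, `n 0` and `g₀` on the two sides alike.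
  rw [hPa, hPc]
  generalize ∏ k ∈ Finset.range d, (theta q ba ca 0 - theta q ba ca (k + 1)) = p1 at *
  generalize ∏ k ∈ Finset.range d, (theta q bc cc 0 - theta q bc cc (k + 1)) = p2 at *
  generalize ∏ j ∈ Finset.range d, gStep q r₀ ca bb cb bc j = p3 at *
  field_simp

end

/-! ### Specialization to the maps and parameters of the Leonard triple. -/

theorem gRatio_succ {q r₀ : ℂ} (hq : q ≠ 0) (b c : Fin 3 → ℂ) (i : Fin 3) (M : ℕ) :
    gRatio q r₀ b c i (M + 1) = gRatio q r₀ b c i M *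
      gStep q r₀ (c i) (b (i + 1)) (c (i + 1)) (b (i + 2)) M := by
  rw [gRatio, Finset.prod_range_succ]
  congr 1
  have e1 : q ^ (4 * (M : ℤ)) = ((q ^ 2) ^ M) ^ 2 := by
    rw [show 4 * (M : ℤ) = ((4 * M : ℕ) : ℤ) by push_cast; ring, zpow_natCast]; ring
  have e2 : q ^ (-2 * (M : ℤ)) = ((q ^ 2) ^ M)⁻¹ := by
    rw [neg_mul, zpow_neg, zpow_mul]; norm_cast
  have e3 : q ^ (2 * (M : ℤ)) = (q ^ 2) ^ M := by rw [zpow_mul]; norm_cast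
  have hm : (q ^ 2) ^ M ≠ 0 := by positivity
  rw [e1, e2, e3, gStep]
  have h1 : c (i + 1) * ((q ^ 2) ^ M)⁻¹ + r₀ * q * c i * b (i + 2) =
      ratioNum q r₀ (c i) (c (i + 1)) (b (i + 2)) M / (q ^ 2) ^ M := by
    rw [ratioNum]; field_simp
  have h2 : b (i + 1) * (q ^ 2) ^ M + r₀ * q⁻¹ * c i * b (i + 2) =
      ratioDen q r₀ (c i) (b (i + 1)) (b (i + 2)) M / q := by
    rw [ratioDen]; field_simp; ring
  rw [h1, h2, div_div_div_eq]
  generalize ratioNum q r₀ (c i) (c (i + 1)) (b (i + 2)) M = U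
  generalize ratioDen q r₀ (c i) (b (i + 1)) (b (i + 2)) M = Z
  generalize b (i + 1) / c (i + 1) = B
  rw [← mul_div_mul_left U Z hm]
  ring

theorem matAB_eq_tri (d : ℕ) (q r₀ : ℂ) (b c : Fin 3 → ℂ) (i : Fin 3) :
    matAB d q r₀ b c i =
      tri d (lowEntry d q r₀ (b i) (c i) (b (i + 1)) (c (i + 1)) (b (i + 2)) (c (i + 2)))
        (diagEntry d q r₀ (b i) (c i) (b (i + 1)) (c (i + 1)) (b (i + 2)) (c (i + 2)))
        (highEntry d q r₀ (b i) (c i) (b (i + 1)) (c (i + 1)) (b (i + 2)) (c (i + 2))) :=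
  rfl

section

variable {d : ℕ} {q r₀ : ℂ} {b c : Fin 3 → ℂ} {A : Fin 3 → Module.End ℂ V}

theorem IsLeonardTriple.low_high_ne_zero (hA : IsLeonardTriple d q r₀ b c A) (i : Fin 3)
    (v : Module.Basis (Fin (d + 1)) ℂ V)
    (hv : ∀ M, A (i + 1) (v M) = theta q (b (i + 1)) (c (i + 1)) M • v M)
    (hact : ∀ M, A i (v M) = ∑ N, matAB d q r₀ b c i N M • v N) (k : ℕ) (hk : k < d) :
    lowEntry d q r₀ (b i) (c i) (b (i + 1)) (c (i + 1)) (b (i + 2)) (c (i + 2)) (k + 1) ≠ 0 ∧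
    highEntry d q r₀ (b i) (c i) (b (i + 1)) (c (i + 1)) (b (i + 2)) (c (i + 2)) (k + 1) ≠ 0 := by
  have hne : i ≠ i + 1 := by fin_cases i <;> decide
  have h := hA.entry_ne_zero hne v hv _ hact
  rw [matAB_eq_tri] at h
  constructor
  · simpa [tri] using h ⟨k + 1, by omega⟩ ⟨k, by omega⟩ (Or.inl rfl)
  · have := h ⟨k, by omega⟩ ⟨k + 1, by omega⟩ (Or.inr rfl)
    rw [tri, Matrix.of_apply, if_neg (by simp; omega), if_pos rfl] at this
    exact this

/-- The expansion of the leading eigenvector of one map in the eigenbasis of the previous one. -/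
theorem IsLeonardTriple.exists_leading_coefficient (hq : q ≠ 0) (hq4 : q ^ 4 ≠ 1) (hr : r₀ ≠ 0)
    (hA : IsLeonardTriple d q r₀ b c A) (i : Fin 3) (v : Module.Basis (Fin (d + 1)) ℂ V)
    (hv : ∀ M, A (i + 1) (v M) = theta q (b (i + 1)) (c (i + 1)) M • v M)
    (hact : ∀ M, A i (v M) = ∑ N, matAB d q r₀ b c i N M • v N) (w : V) (hw0 : w ≠ 0)
    (hw : A (i + 2) w = theta q (b (i + 2)) (c (i + 2)) 0 • w) :
    ∃ t : ℂ, t ≠ 0 ∧ w = ∑ M : Fin (d + 1), (t * gRatio q r₀ b c i M) • v M := by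
  have hlh := hA.low_high_ne_zero i v hv hact
  have hU : ∀ k < d, ratioNum q r₀ (c i) (c (i + 1)) (b (i + 2)) k ≠ 0 := by
    intro k hk h
    apply (hlh k hk).1
    rw [lowEntry_succ hq hr (hA.param _) (hA.param _) (hA.param _), h]; simp
  have hZ : ∀ k < d, ratioDen q r₀ (c i) (b (i + 1)) (b (i + 2)) k ≠ 0 := by
    intro k hk h
    apply (hlh k hk).2
    rw [highEntry_succ hq hr (hA.param _) (hA.param _) (hA.param _), h]; simp
  have hact' := hact
  rw [matAB_eq_tri] at hact'
  have h1 := map_sum_smul_basis v (A (i + 2)) _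
    (third_apply_basis hq hq4 hv hact' (hA.third_eq hq hq4 hr i))
    (fun M => gRatio q r₀ b c i M)
  simp only [third_ratio_vector hq hq4 hr (hA.param i) (hA.param (i + 1)) (hA.param (i + 2))
    (hA.sub_ne_zero hq (i + 1)) hU hZ (gRatio q r₀ b c i)
    (fun k _ => gRatio_succ hq b c i k)] at h1
  have h2 : A (i + 2) (∑ M : Fin (d + 1), gRatio q r₀ b c i M • v M) =
      theta q (b (i + 2)) (c (i + 2)) 0 • ∑ M : Fin (d + 1), gRatio q r₀ b c i M • v M := by
    rw [h1, Finset.smul_sum]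
    simp only [smul_smul]
  have h3 : ∑ M : Fin (d + 1), gRatio q r₀ b c i M • v M ≠ 0 := by
    intro h
    have h4 := congrFun (congrArg (fun f : Fin (d + 1) →₀ ℂ => (f : Fin (d + 1) → ℂ))
      (congrArg v.repr h)) 0
    simp only [v.repr_sum_self fun M => gRatio q r₀ b c i M, map_zero] at h4
    simp [gRatio] at h4
  obtain ⟨t, ht⟩ := hA.exists_smul_eq (i + 2) h2 hw h3
  refine ⟨t, ?_, ?_⟩
  · rintro rfl
    rw [zero_smul] at ht
    exact hw0 ht
  · rw [ht, Finset.smul_sum]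
    simp only [smul_smul]

end

end QRacahTriple

end

theorem mainTheorem9 {V : Type*} [AddCommGroup V] [Module ℂ V]
    (d : ℕ) (q r₀ : ℂ) (hq : q ≠ 0) (hroot : ∀ n : ℕ, 0 < n → q ^ n ≠ 1) (hr : r₀ ≠ 0)
    (b c : Fin 3 → ℂ) (A : Fin 3 → Module.End ℂ V)
    (hA : QRacahTriple.IsLeonardTriple d q r₀ b c A)
    (i : Fin 3) (va vb vc : Module.Basis (Fin (d + 1)) ℂ V)
    (hv : QRacahTriple.IsEigenbases d q r₀ b c A i va vb vc) :
    (∃ f₀ g₀ h₀ : ℂ, QRacahTriple.IsNormalization d q r₀ b c i va vb vc f₀ g₀ h₀) ∧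
    ∀ f₀ g₀ h₀ : ℂ, QRacahTriple.IsNormalization d q r₀ b c i va vb vc f₀ g₀ h₀ →
      f₀ * h₀⁻¹ * g₀⁻¹ =
        (-1) ^ d * q ^ ((d : ℤ) * ((d : ℤ) - 1)) *
          ((QRacahTriple.qPoch (q ^ 2 * r₀ ^ 2 * b 0 ^ 2) (q ^ 2) d
            * QRacahTriple.qPoch (q ^ 2 * r₀ ^ 2 * b 2 ^ 2) (q ^ 2) d
            * QRacahTriple.qPoch (q ^ 2 * r₀ ^ 2 * b 1 ^ 2) (q ^ 2) d) /
          (QRacahTriple.qPoch (-(q * r₀ * b 0 * b 2 / b 1)) (q ^ 2) d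
            * QRacahTriple.qPoch (-(q * r₀ * b 0 * b 1 / b 2)) (q ^ 2) d
            * QRacahTriple.qPoch (-(q * r₀ * b 2 * b 1 / b 0)) (q ^ 2) d)) := by
  have hq4 := hroot 4 (by norm_num)
  have hqd : ∀ k, 0 < k → (q ^ 2) ^ k ≠ 1 := fun k hk => by
    rw [← pow_mul]; exact hroot _ (by omega)
  have i3 : i + 1 + 1 = i + 2 := by rw [add_assoc]; rfl
  have i4 : i + 1 + 2 = i := by fin_cases i <;> rfl
  -- The ratios of h are the ratios of g for the next cyclic order, so one existence lemma serves
  -- both expansions.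
  have hhg : ∀ M, QRacahTriple.hRatio q r₀ b c i M = QRacahTriple.gRatio q r₀ b c (i + 1) M := by
    intro M
    rw [QRacahTriple.hRatio, QRacahTriple.gRatio, i3, i4]
  constructor
  · obtain ⟨g₀, hg0, hg⟩ := hA.exists_leading_coefficient hq hq4 hr i vb hv.eig_b hv.act_b (vc 0)
      (vc.ne_zero 0) (hv.eig_c 0)
    obtain ⟨h₀, hh0, hh⟩ := hA.exists_leading_coefficient hq hq4 hr (i + 1) vc
      (by rw [i3]; exact hv.eig_c) hv.act_c (va 0) (va.ne_zero 0) (by rw [i4]; exact hv.eig_a 0)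
    -- Only the quotient h₀/f₀ enters the expansion of `va 0`, so f₀ may be chosen as 1.
    refine ⟨1, g₀, h₀, one_ne_zero, hg0, hh0, hg, ?_⟩
    simpa [hhg] using hh
  · intro f₀ g₀ h₀ hN
    have hact := hv.act_b
    rw [QRacahTriple.matAB_eq_tri] at hact
    have hlh := hA.low_high_ne_zero i vb hv.eig_b hv.act_b
    have key := QRacahTriple.leading_coefficient_product hq hqd hq4 hr (hA.param i)
      (hA.param (i + 1)) (hA.param (i + 2)) (hA.theta_injective i) (hA.theta_injective (i + 1))
      (hA.theta_injective (i + 2)) (hA.sub_ne_zero hq (i + 1)) (fun k hk => (hlh k hk).1)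
      (fun k hk => (hlh k hk).2) hv.eig_b hact (hA.third_eq hq hq4 hr i) hv.eig_a hv.eig_c
      (hA.exists_smul_eq i) hv.rel (QRacahTriple.gRatio q r₀ b c i)
      (by simp [QRacahTriple.gRatio]) (fun k _ => QRacahTriple.gRatio_succ hq b c i k) g₀ hN.c_to_b
    have hH : vc.repr (va 0) 0 = f₀⁻¹ * h₀ := by
      rw [hN.a_to_c, vc.repr_sum_self fun M =>
        f₀⁻¹ * (h₀ * QRacahTriple.hRatio q r₀ b c i M)]
      simp [QRacahTriple.hRatio]
    rw [hH] at key
    have hinv : f₀ * h₀⁻¹ * g₀⁻¹ = (g₀ * (f₀⁻¹ * h₀))⁻¹ := by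
      rw [mul_inv, mul_inv, inv_inv]; ring
    rw [hinv, key, mul_inv, inv_inv, inv_div]
    congr 1
    have hswap : ∀ x y z : ℂ, q * r₀ * x * y / z = q * r₀ * y * x / z := by intros; ring
    -- The product formula is invariant under cyclic permutation of the three maps; only the order
    -- of the factors differs.
    fin_cases i
    · change QRacahTriple.qPoch (q ^ 2 * r₀ ^ 2 * b 0 ^ 2) (q ^ 2) d * QRacahTriple.qPoch (q ^ 2 * r₀ ^ 2 * b 1 ^ 2) (q ^ 2) d * QRacahTriple.qPoch (q ^ 2 * r₀ ^ 2 * b 2 ^ 2) (q ^ 2) d /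
        (QRacahTriple.qPoch (-(q * r₀ * b 1 * b 2 / b 0)) (q ^ 2) d *
          QRacahTriple.qPoch (-(q * r₀ * b 0 * b 1 / b 2)) (q ^ 2) d *
          QRacahTriple.qPoch (-(q * r₀ * b 0 * b 2 / b 1)) (q ^ 2) d) = _
      rw [hswap (b 1) (b 2) (b 0)]
      ring
    · change QRacahTriple.qPoch (q ^ 2 * r₀ ^ 2 * b 1 ^ 2) (q ^ 2) d * QRacahTriple.qPoch (q ^ 2 * r₀ ^ 2 * b 2 ^ 2) (q ^ 2) d * QRacahTriple.qPoch (q ^ 2 * r₀ ^ 2 * b 0 ^ 2) (q ^ 2) d /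
        (QRacahTriple.qPoch (-(q * r₀ * b 2 * b 0 / b 1)) (q ^ 2) d *
          QRacahTriple.qPoch (-(q * r₀ * b 1 * b 2 / b 0)) (q ^ 2) d *
          QRacahTriple.qPoch (-(q * r₀ * b 1 * b 0 / b 2)) (q ^ 2) d) = _
      rw [hswap (b 2) (b 0) (b 1), hswap (b 1) (b 2) (b 0), hswap (b 1) (b 0) (b 2)]
      ring
    · change QRacahTriple.qPoch (q ^ 2 * r₀ ^ 2 * b 2 ^ 2) (q ^ 2) d * QRacahTriple.qPoch (q ^ 2 * r₀ ^ 2 * b 0 ^ 2) (q ^ 2) d * QRacahTriple.qPoch (q ^ 2 * r₀ ^ 2 * b 1 ^ 2) (q ^ 2) d /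
        (QRacahTriple.qPoch (-(q * r₀ * b 0 * b 1 / b 2)) (q ^ 2) d *
          QRacahTriple.qPoch (-(q * r₀ * b 2 * b 0 / b 1)) (q ^ 2) d *
          QRacahTriple.qPoch (-(q * r₀ * b 2 * b 1 / b 0)) (q ^ 2) d) = _
      rw [hswap (b 2) (b 0) (b 1)]
      ring
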